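/- All abelian varieties are over $\mathbb C$ and all representations are finite dimensional. For an abelian variety $A$ let $\operatorname{End}(A)$ be its endomorphism ring, $D(A)=\operatorname{End}(A)\otimes\mathbb Q$, and let $G(A)$ be its Hodge group: the smallest algebraic subgroup of $GL(H^1(A,\mathbb Q))$, defined over $\mathbb Q$, whose group of real points contains the image of the homomorphism $h\colon U(1)\to GL(H^1(A,\mathbb R))$ which gives the complex structure. Let $G'(A)$ be the derived group of $G(A)$. Let $L(A)$ be the Lefschetz group of $A$: the centralizer of $\operatorname{End}(A)$ in the symplectic group of a Riemann form of $A$ (it does not depend on the Riemann form). All these groups act diagonally on $H^1(A^d,\mathbb Q)=H^1(A,\mathbb Q)^d$, hence on $H^c(A^d,\mathbb C)=\bigwedge^c H^1(A^d,\mathbb C)$, for all $c,d$. For $\sigma\in\operatorname{Aut}(\mathbb C)$ and a subspace $V\subset H^c(A^d,\mathbb C)=H^c(A^d,\mathbb Q)\otimes\mathbb C$, let $V^\sigma=(\mathrm{id}\otimes\sigma)(V)$. We say that $A$ is of CM-type if $D(A)$ contains a commutative semisimple $\mathbb Q$-algebra of dimension $2\dim A$. We say that $A$ is weakly self-dominated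 if, given any nontrivial irreducible (algebraic) representation $\rho$ of $G'(A)(\mathbb C)$, there exist positive integers $c_\rho$, $d_\rho$ and an $L(A)(\mathbb C)$-submodule $V_\rho$ of $H^{c_\rho}(A^{d_\rho},\mathbb C)$ such that the action of $G'(A)(\mathbb C)$ on $V_\rho$ is equivalent to $\rho$ and, for each $\sigma\in\operatorname{Aut}(\mathbb C)$, the conjugate $(V_\rho)^\sigma$ contains a nonzero $(c_\rho,0)$-form. Lemma. (1) Any abelian variety of CM-type is weakly self-dominated. (2) If $A$ is weakly self-dominated, then so is any power $A^n$ of $A$. (3) If $A$ and $B$ are weakly self-dominated abelian varieties such that $G'(A\times B)=G'(A)\times G'(B)$ (as subgroups of $GL(H^1(A\times B,\mathbb Q))$, where $H^1(A\times B,\mathbb Q)=H^1(A,\mathbb Q)\oplus H^1(B,\mathbb Q)$), then $A\times B$ is also weakly self-dominated. -/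

import Mathlib

open scoped TensorProduct

universe u

noncomputable section

/-- `β` is a Riemann form for the complex torus `E / Λ`: a real alternating form on `E`, integral on
`Λ`, with `β (ix, iy) = β (x, y)` and such that the Hermitian form `β (ix, y) + i β (x, y)` is
positive definite. -/
structure IsRiemannForm {E : Type u} [NormedAddCommGroup E] [NormedSpace ℂ E]
    (Λ : Submodule ℤ E) (β : LinearMap.BilinForm ℝ E) : Prop where
  alt : ∀ x, β x x = 0
  integral : ∀ x ∈ Λ, ∀ y ∈ Λ, ∃ k : ℤ, β x y = k
  hermitian : ∀ x y, β (Complex.I • x) (Complex.I • y) = β x y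
  pos : ∀ x, x ≠ 0 → 0 < β (Complex.I • x) x

/-- An abelian variety over `ℂ`, as a complex torus `Lie / lattice` which admits a Riemann form.
(The norm only serves to carry the topology of the finite dimensional space `Lie`.) -/
structure AbelianVariety : Type (u + 1) where
  Lie : Type u
  [normed : NormedAddCommGroup Lie]
  [normedSpace : NormedSpace ℂ Lie]
  [finiteDimensional : FiniteDimensional ℂ Lie]
  lattice : Submodule ℤ Lie
  [discrete : DiscreteTopology lattice]
  [isZLattice : IsZLattice ℝ lattice]
  polarizable : ∃ β : LinearMap.BilinForm ℝ Lie, IsRiemannForm lattice β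

namespace AbelianVariety

attribute [instance] normed normedSpace finiteDimensional discrete isZLattice

/-- The dimension of an abelian variety. -/
def dim (A : AbelianVariety.{u}) : ℕ := Module.finrank ℂ A.Lie

/-! ### Products and powers -/

theorem discreteTopology_prod {E F : Type u} [NormedAddCommGroup E] [NormedAddCommGroup F]
    (L : Submodule ℤ E) (M : Submodule ℤ F) [DiscreteTopology L] [DiscreteTopology M] :
    DiscreteTopology (L.prod M) := by
  have h : Topology.IsEmbedding
      (fun x : L.prod M => ((⟨x.1.1, x.2.1⟩, ⟨x.1.2, x.2.2⟩) : L × M)) := by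
    refine Topology.IsEmbedding.of_comp (by fun_prop)
      (g := fun p : L × M => ((p.1 : E), (p.2 : F))) (by fun_prop) ?_
    exact Topology.IsEmbedding.subtypeVal
  exact h.discreteTopology

theorem discreteTopology_pi {E : Type u} [NormedAddCommGroup E]
    (L : Submodule ℤ E) [DiscreteTopology L] (d : ℕ) :
    DiscreteTopology (Submodule.pi Set.univ fun _ : Fin d => L) := by
  have h : Topology.IsEmbedding
      (fun (x : (Submodule.pi Set.univ fun _ : Fin d => L)) (i : Fin d) =>
        (⟨x.1 i, x.2 i trivial⟩ : L)) := by
    refine Topology.IsEmbedding.of_comp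
      (continuous_pi fun i => Continuous.subtype_mk
        ((continuous_apply i).comp continuous_subtype_val) _)
      (g := fun (p : Fin d → L) (i : Fin d) => (p i : E)) (by fun_prop) ?_
    exact Topology.IsEmbedding.subtypeVal
  exact h.discreteTopology

/-- The product `A × B`. -/
def prod (A B : AbelianVariety.{u}) : AbelianVariety.{u} where
  Lie := A.Lie × B.Lie
  lattice := A.lattice.prod B.lattice
  discrete := discreteTopology_prod A.lattice B.lattice
  isZLattice := by
    have := discreteTopology_prod A.lattice B.lattice
    refine ⟨?_⟩
    rw [eq_top_iff]
    rintro ⟨x, y⟩ -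
    have hx : x ∈ Submodule.span ℝ (A.lattice : Set A.Lie) := by
      rw [IsZLattice.span_top (K := ℝ) (L := A.lattice)]; trivial
    have hy : y ∈ Submodule.span ℝ (B.lattice : Set B.Lie) := by
      rw [IsZLattice.span_top (K := ℝ) (L := B.lattice)]; trivial
    have h1 := Submodule.apply_mem_span_image_of_mem_span
      ((LinearMap.inl ℂ A.Lie B.Lie).restrictScalars ℝ) hx
    have h2 := Submodule.apply_mem_span_image_of_mem_span
      ((LinearMap.inr ℂ A.Lie B.Lie).restrictScalars ℝ) hy
    have h3 := Submodule.add_mem _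
      (Submodule.span_mono (t := ((A.lattice.prod B.lattice : Submodule ℤ (A.Lie × B.Lie)) :
        Set (A.Lie × B.Lie))) (by rintro _ ⟨a, ha, rfl⟩; exact ⟨ha, B.lattice.zero_mem⟩) h1)
      (Submodule.span_mono (by rintro _ ⟨a, ha, rfl⟩; exact ⟨A.lattice.zero_mem, ha⟩) h2)
    simpa using h3
  polarizable := by
    obtain ⟨β, hβ⟩ := A.polarizable
    obtain ⟨γ, hγ⟩ := B.polarizable
    refine ⟨β.compl₁₂ ((LinearMap.fst ℂ A.Lie B.Lie).restrictScalars ℝ)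
        ((LinearMap.fst ℂ A.Lie B.Lie).restrictScalars ℝ) +
      γ.compl₁₂ ((LinearMap.snd ℂ A.Lie B.Lie).restrictScalars ℝ)
        ((LinearMap.snd ℂ A.Lie B.Lie).restrictScalars ℝ), ?_, ?_, ?_, ?_⟩
    · intro x; simp [hβ.alt, hγ.alt]
    · intro x hx y hy
      obtain ⟨k, hk⟩ := hβ.integral _ hx.1 _ hy.1
      obtain ⟨l, hl⟩ := hγ.integral _ hx.2 _ hy.2
      exact ⟨k + l, by simp [hk, hl]⟩
    · intro x y; simp [hβ.hermitian, hγ.hermitian]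
    · rintro ⟨x, y⟩ h
      have hx : 0 ≤ β (Complex.I • x) x := by
        by_cases h0 : x = 0
        · simp [h0]
        · exact (hβ.pos x h0).le
      have hy : 0 ≤ γ (Complex.I • y) y := by
        by_cases h0 : y = 0
        · simp [h0]
        · exact (hγ.pos y h0).le
      by_cases h0 : x = 0
      · have h1 : y ≠ 0 := by rintro rfl; exact h (by simp [h0])
        simpa using add_pos_of_nonneg_of_pos hx (hγ.pos y h1)
      · simpa using add_pos_of_pos_of_nonneg (hβ.pos x h0) hy

/-- The power `A ^ d`. -/
def pow (A : AbelianVariety.{u}) (d : ℕ) : AbelianVariety.{u} where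
  Lie := Fin d → A.Lie
  lattice := Submodule.pi Set.univ fun _ => A.lattice
  discrete := discreteTopology_pi A.lattice d
  isZLattice := by
    have := discreteTopology_pi A.lattice d
    refine ⟨?_⟩
    rw [eq_top_iff]
    rintro x -
    have hx : ∀ i, x i ∈ Submodule.span ℝ (A.lattice : Set A.Lie) := by
      intro i; rw [IsZLattice.span_top (K := ℝ) (L := A.lattice)]; trivial
    have h1 := fun i => Submodule.span_mono
      (t := ((Submodule.pi Set.univ fun _ : Fin d => A.lattice : Submodule ℤ (Fin d → A.Lie)) :
        Set (Fin d → A.Lie))) (by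
          rintro _ ⟨a, ha, rfl⟩ j -
          by_cases hj : j = i
          · subst hj; simpa using ha
          · simp [hj])
      (Submodule.apply_mem_span_image_of_mem_span
        ((LinearMap.single ℂ (fun _ : Fin d => A.Lie) i).restrictScalars ℝ) (hx i))
    have h2 := Submodule.sum_mem _ fun i (_ : i ∈ Finset.univ) => h1 i
    have h3 : x = ∑ i, ((LinearMap.single ℂ (fun _ : Fin d => A.Lie) i).restrictScalars ℝ) (x i) :=
      (Finset.univ_sum_single x).symm
    rw [h3]
    exact h2
  polarizable := by
    obtain ⟨β, hβ⟩ := A.polarizable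
    have h0 : ∀ x, 0 ≤ β (Complex.I • x) x := by
      intro x
      by_cases h0 : x = 0
      · simp [h0]
      · exact (hβ.pos x h0).le
    refine ⟨∑ i, β.compl₁₂ ((LinearMap.proj (R := ℂ) (φ := fun _ : Fin d => A.Lie)
        i).restrictScalars ℝ) ((LinearMap.proj (R := ℂ) (φ := fun _ : Fin d => A.Lie)
        i).restrictScalars ℝ), ?_, ?_, ?_, ?_⟩
    · intro x; simp [LinearMap.sum_apply, hβ.alt]
    · intro x hx y hy
      choose k hk using fun i => hβ.integral _ (hx i trivial) _ (hy i trivial)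
      exact ⟨∑ i, k i, by simp [LinearMap.sum_apply, hk]⟩
    · intro x y; simp [LinearMap.sum_apply, hβ.hermitian]
    · intro x hx
      obtain ⟨i, hi⟩ := Function.ne_iff.1 hx
      have := Finset.sum_pos' (s := Finset.univ) (f := fun i => β (Complex.I • x i) (x i))
        (fun i _ => h0 _) ⟨i, Finset.mem_univ _, hβ.pos _ hi⟩
      simpa [LinearMap.sum_apply] using this

/-! The `ℂ`-linear maps which present `Lie (A × B)` and `Lie (A ^ d)` as direct sums. -/

/-- The first projection `Lie (A × B) → Lie A`. -/
def fst (A B : AbelianVariety.{u}) : (A.prod B).Lie →ₗ[ℂ] A.Lie := LinearMap.fst ℂ A.Lie B.Lie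

/-- The second projection `Lie (A × B) → Lie B`. -/
def snd (A B : AbelianVariety.{u}) : (A.prod B).Lie →ₗ[ℂ] B.Lie := LinearMap.snd ℂ A.Lie B.Lie

/-- The inclusion `Lie A → Lie (A × B)`. -/
def inl (A B : AbelianVariety.{u}) : A.Lie →ₗ[ℂ] (A.prod B).Lie := LinearMap.inl ℂ A.Lie B.Lie

/-- The inclusion `Lie B → Lie (A × B)`. -/
def inr (A B : AbelianVariety.{u}) : B.Lie →ₗ[ℂ] (A.prod B).Lie := LinearMap.inr ℂ A.Lie B.Lie

/-- The `i`-th projection `Lie (A ^ d) → Lie A`. -/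
def proj (A : AbelianVariety.{u}) (d : ℕ) (i : Fin d) : (A.pow d).Lie →ₗ[ℂ] A.Lie :=
  LinearMap.proj (R := ℂ) (φ := fun _ : Fin d => A.Lie) i

/-- The inclusion `Lie A → Lie (A ^ d)` of the `i`-th factor. -/
def single (A : AbelianVariety.{u}) (d : ℕ) (i : Fin d) : A.Lie →ₗ[ℂ] (A.pow d).Lie :=
  LinearMap.single ℂ (fun _ : Fin d => A.Lie) i

/-! ### Homology and cohomology -/

/-- `H₁(A, ℂ) = H₁(A, ℝ) ⊗ ℂ`, where `H₁(A, ℝ) = Lie A` and `H₁(A, ℤ)` is the lattice. -/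
abbrev H₁ (A : AbelianVariety.{u}) : Type u := ℂ ⊗[ℝ] A.Lie

/-- The map induced on `H₁(-, ℂ)` by a `ℂ`-linear map of Lie algebras. -/
def H₁map {A B : AbelianVariety.{u}} (f : A.Lie →ₗ[ℂ] B.Lie) : A.H₁ →ₗ[ℂ] B.H₁ :=
  (f.restrictScalars ℝ).baseChange ℂ

/-- The group of complex points of `GL(H₁(A, ℚ))`, which is identified with `GL(H¹(A, ℚ))` through
the contragredient action. -/
abbrev GLH₁ (A : AbelianVariety.{u}) : Type u := A.H₁ ≃ₗ[ℂ] A.H₁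

/-- `Hⁿ(A, ℂ) = ⋀ⁿ H¹(A, ℂ)`, the space of alternating `n`-forms on `H₁(A, ℂ)`. -/
abbrev Coh (A : AbelianVariety.{u}) (n : ℕ) : Type u := A.H₁ [⋀^Fin n]→ₗ[ℂ] ℂ

/-- `φ ∈ Hⁿ(A, ℂ)` is of Hodge type `(n, 0)`: as an invariant differential form on `A`, that is, as
an `n`-form on the real vector space `Lie A`, it is `ℂ`-multilinear. -/
def IsHolomorphicForm (A : AbelianVariety.{u}) {n : ℕ} (φ : A.Coh n) : Prop :=
  ∃ ω : A.Lie [⋀^Fin n]→ₗ[ℂ] ℂ, ∀ x : Fin n → A.Lie, φ (fun i => 1 ⊗ₜ x i) = ω x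

/-- `ψ` is the conjugate `φ^σ` of `φ ∈ Hⁿ(A, ℂ) = Hⁿ(A, ℚ) ⊗ ℂ`, where `σ ∈ Aut(ℂ)` acts on the
second factor: the values on the lattice are conjugated by `σ`. -/
def IsConjugate (A : AbelianVariety.{u}) {n : ℕ} (σ : ℂ ≃+* ℂ) (φ ψ : A.Coh n) : Prop :=
  ∀ l : Fin n → A.Lie, (∀ i, l i ∈ A.lattice) →
    ψ (fun i => 1 ⊗ₜ l i) = σ (φ (fun i => 1 ⊗ₜ l i))

/-- The conjugate `V^σ` of a subset (in practice a subspace) of `Hⁿ(A, ℂ)`. -/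
def conjugate (A : AbelianVariety.{u}) {n : ℕ} (σ : ℂ ≃+* ℂ) (V : Set (A.Coh n)) :
    Set (A.Coh n) :=
  {ψ | ∃ φ ∈ V, A.IsConjugate σ φ ψ}

/-- The diagonal action of an endomorphism of `H₁(A, ℂ)` on `H₁(A ^ d, ℂ) = H₁(A, ℂ) ^ d`. -/
def diag (A : AbelianVariety.{u}) (d : ℕ) (g : Module.End ℂ A.H₁) :
    Module.End ℂ (A.pow d).H₁ :=
  ∑ i : Fin d, H₁map (A.single d i) ∘ₗ g ∘ₗ H₁map (A.proj d i)

/-- The action of `GL(H₁(A, ℂ))` on `Hⁿ(A ^ d, ℂ)`. -/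
def act (A : AbelianVariety.{u}) {d n : ℕ} (g : A.GLH₁) (φ : (A.pow d).Coh n) : (A.pow d).Coh n :=
  φ.compLinearMap (A.diag d (g⁻¹ : A.GLH₁).toLinearMap)

/-- The block diagonal endomorphism of `H₁(A × B, ℂ) = H₁(A, ℂ) ⊕ H₁(B, ℂ)` with blocks
`a` and `b`. -/
def blockDiag (A B : AbelianVariety.{u}) (a : Module.End ℂ A.H₁) (b : Module.End ℂ B.H₁) :
    Module.End ℂ (A.prod B).H₁ :=
  H₁map (inl A B) ∘ₗ a ∘ₗ H₁map (fst A B) + H₁map (inr A B) ∘ₗ b ∘ₗ H₁map (snd A B)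

/-! ### Algebraic groups -/

/-- The regular functions on `GL(H₁(A, ℚ))` with rational coefficients, as functions on the complex
points: the `ℚ`-algebra generated by the functions `g ↦ ℓ (g v)` and `g ↦ ℓ (g⁻¹ v)` with
`v ∈ H₁(A, ℤ)` and `ℓ ∈ H¹(A, ℚ)`. -/
def rationalFunctions (A : AbelianVariety.{u}) : Subalgebra ℚ (A.GLH₁ → ℂ) :=
  Algebra.adjoin ℚ {f | ∃ v ∈ A.lattice, ∃ l : A.H₁ →ₗ[ℂ] ℂ,
    (∀ w ∈ A.lattice, ∃ q : ℚ, l (1 ⊗ₜ w) = q) ∧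
      ((f = fun g => l (g (1 ⊗ₜ v))) ∨ (f = fun g => l (g⁻¹ (1 ⊗ₜ v))))}

/-- The regular functions on the complex algebraic group `GL(H₁(A, ℂ))`. -/
def regularFunctions (A : AbelianVariety.{u}) : Subalgebra ℂ (A.GLH₁ → ℂ) :=
  Algebra.adjoin ℂ {f | ∃ (v : A.H₁) (l : A.H₁ →ₗ[ℂ] ℂ),
    (f = fun g => l (g v)) ∨ (f = fun g => l (g⁻¹ v))}

/-- `H` is the group of complex points of an algebraic subgroup of `GL(H₁(A, ℚ))` which is defined
over `ℚ`. -/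
def IsRationalAlgebraic (A : AbelianVariety.{u}) (H : Subgroup A.GLH₁) : Prop :=
  ∃ S : Set (A.GLH₁ → ℂ), S ⊆ A.rationalFunctions ∧ ∀ g, g ∈ H ↔ ∀ f ∈ S, f g = 0

/-- The complex structure `h : U(1) → GL(H₁(A, ℝ)) ⊆ GL(H₁(A, ℂ))`: the number `z` acts on
`H₁(A, ℝ) = Lie A` as multiplication by `z`. -/
def hodgeHom (A : AbelianVariety.{u}) (z : Circle) : A.GLH₁ :=
  ((LinearEquiv.smulOfNeZero ℂ A.Lie (z : ℂ) z.coe_ne_zero).restrictScalars ℝ).baseChange ℝ ℂ _ _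

/-- The complex points of the Hodge group `G(A)`, the smallest algebraic subgroup defined over `ℚ`
whose group of real points contains `h(U(1))`. -/
def hodgeGroup (A : AbelianVariety.{u}) : Subgroup A.GLH₁ :=
  sInf {H | A.IsRationalAlgebraic H ∧ ∀ z, A.hodgeHom z ∈ H}

/-- The complex points of the derived group `G'(A)` of the Hodge group; these form the commutator
subgroup of `G(A)(ℂ)`. -/
def derivedHodgeGroup (A : AbelianVariety.{u}) : Subgroup A.GLH₁ :=
  ⁅A.hodgeGroup, A.hodgeGroup⁆

/-- The equality `G'(A × B) = G'(A) × G'(B)` of subgroups of `GL(H₁(A × B))`. -/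
def DerivedHodgeGroupIsProduct (A B : AbelianVariety.{u}) : Prop :=
  ∀ g : (A.prod B).GLH₁, g ∈ (A.prod B).derivedHodgeGroup ↔
    ∃ a ∈ A.derivedHodgeGroup, ∃ b ∈ B.derivedHodgeGroup,
      g.toLinearMap = blockDiag A B a.toLinearMap b.toLinearMap

/-- The ring `End(A)` of endomorphisms of `A`: the `ℂ`-linear maps which preserve the lattice. -/
def endRing (A : AbelianVariety.{u}) : Subring (Module.End ℂ A.Lie) where
  carrier := {f | ∀ x ∈ A.lattice, f x ∈ A.lattice}
  mul_mem' hf hg x hx := hf _ (hg x hx)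
  one_mem' _ hx := hx
  add_mem' hf hg x hx := A.lattice.add_mem (hf x hx) (hg x hx)
  zero_mem' _ _ := A.lattice.zero_mem
  neg_mem' hf x hx := A.lattice.neg_mem (hf x hx)

/-- The complex points of the Lefschetz group `L(A)`: the centralizer of `End(A)` in the symplectic
group of a Riemann form. (As any two Riemann forms differ by an element of `End(A) ⊗ ℚ`, it is the
same to preserve one of them or all of them.) -/
def lefschetzGroup (A : AbelianVariety.{u}) : Subgroup A.GLH₁ where
  carrier := {g | (∀ f ∈ A.endRing, ∀ x, g (H₁map f x) = H₁map f (g x)) ∧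
    ∀ β, IsRiemannForm A.lattice β → ∀ x y, β.baseChange ℂ (g x) (g y) = β.baseChange ℂ x y}
  mul_mem' {g h} hg hh := by
    refine ⟨fun f hf x => ?_, fun β hβ x y => ?_⟩
    · rw [LinearEquiv.mul_apply, LinearEquiv.mul_apply, hh.1 f hf, hg.1 f hf]
    · rw [LinearEquiv.mul_apply, LinearEquiv.mul_apply, hg.2 β hβ, hh.2 β hβ]
  one_mem' := ⟨fun _ _ _ => rfl, fun _ _ _ _ => rfl⟩
  inv_mem' {g} hg := by
    have hi : ∀ x, g (g⁻¹ x) = x := g.apply_symm_apply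
    refine ⟨fun f hf x => g.injective ?_, fun β hβ x y => ?_⟩
    · rw [hi, hg.1 f hf, hi]
    · rw [← hg.2 β hβ, hi, hi]

/-! ### CM-type and weak self-domination -/

/-- `A` is of CM-type: the algebra `D(A) = End(A) ⊗ ℚ` contains a commutative semisimple
`ℚ`-algebra of dimension `2 dim A`. -/
def IsCMType (A : AbelianVariety.{u}) : Prop :=
  ∃ S : Subalgebra ℚ (ℚ ⊗[ℤ] A.endRing), (∀ x ∈ S, ∀ y ∈ S, x * y = y * x) ∧
    IsSemisimpleRing S ∧ Module.finrank ℚ S = 2 * A.dim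

/-- A representation of `G'(A)(ℂ)` is algebraic if its matrix coefficients are regular functions. -/
def IsAlgebraicRep (A : AbelianVariety.{u}) {U : Type} [AddCommGroup U] [Module ℂ U]
    (ρ : Representation ℂ A.derivedHodgeGroup U) : Prop :=
  ∀ (v : U) (l : U →ₗ[ℂ] ℂ), ∃ f ∈ A.regularFunctions, ∀ g, l (ρ g v) = f g

/-- `A` is weakly self-dominated. -/
def IsWeaklySelfDominated (A : AbelianVariety.{u}) : Prop :=
  ∀ (U : Type) [AddCommGroup U] [Module ℂ U] [FiniteDimensional ℂ U]
    (ρ : Representation ℂ A.derivedHodgeGroup U),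
    A.IsAlgebraicRep ρ → ρ.IsIrreducible → (∃ g v, ρ g v ≠ v) →
    ∃ c d : ℕ, 0 < c ∧ 0 < d ∧ ∃ V : Submodule ℂ ((A.pow d).Coh c),
      (∀ g ∈ A.lefschetzGroup, ∀ φ ∈ V, A.act g φ ∈ V) ∧
      (∃ e : U ≃ₗ[ℂ] V, ∀ (g : A.derivedHodgeGroup) (v : U),
        (e (ρ g v) : (A.pow d).Coh c) = A.act (g : A.GLH₁) (e v : (A.pow d).Coh c)) ∧
      ∀ σ : ℂ ≃+* ℂ, ∃ ψ ∈ (A.pow d).conjugate σ (V : Set ((A.pow d).Coh c)),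
        ψ ≠ 0 ∧ (A.pow d).IsHolomorphicForm ψ

end AbelianVariety

end

/-!
# Weak self-domination for abelian varieties of CM-type, powers and products

**CM-type.** A commutative semisimple algebra `S ⊆ D(A)` of dimension `2 dim A` acts faithfully on
`H₁(A, ℚ)`, which has the same dimension, so it has a cyclic vector (`exists_cyclic_vector`). Hence
the commutant of `S` in `GL(H₁(A, ℂ))` is commutative (`commutant_commute`). This commutant is
algebraic over `ℚ` and contains the complex structure, so it contains the Hodge group: `G'(A)` is
trivial and has no nontrivial irreducible representation.

**Powers.** For `n > 0` the Hodge group of `A ^ n` is that of `A`, embedded diagonally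
(`hodgeGroup_pow`), and the Lefschetz group of `A ^ n` acts on each factor through that of `A`
(`exists_mem_lefschetzGroup`). So a realisation of a representation of `G'(A)` in the cohomology of
`A ^ d` is pulled back along a coordinate projection `(A ^ n) ^ d → A ^ d`.

**Products.** An irreducible representation of `G'(A) × G'(B)` is an external tensor product
`W ⊗ M` (`Representation.exists_externalTensor`). Let `W` and `M` be realised on spaces of forms on
`A ^ d` and `B ^ d'`. Pull these back to `(A × B) ^ (d + d')` along projections which use disjoint
sets of coordinates, and take wedge products; the result is `W ⊗ M`, by the injectivity of the
Künneth map (`cross_injective`). Conjugation, the Hodge type and the action of the Lefschetz group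
are all compatible with pullbacks and wedge products (`Realises.cross`). One factor may be trivial
as a representation; it is then realised by constants in degree `0`
(`IsWeaklySelfDominated.exists_realises`).
-/

noncomputable section

/-! ### Representations of products of groups -/

namespace Representation

/-- **Burnside's theorem**: over an algebraically closed field, the operators of a finite
dimensional irreducible representation span all endomorphisms. -/
theorem IsIrreducible.asAlgebraHom_surjective {k G W : Type*} [Field k] [IsAlgClosed k] [Group G]
    [AddCommGroup W] [Module k W] [FiniteDimensional k W] (ρ : Representation k G W)
    [hρ : ρ.IsIrreducible] : Function.Surjective ρ.asAlgebraHom := by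
  classical
  intro f
  have hs : IsSimpleModule (MonoidAlgebra k G) ρ.asModule := inferInstance
  have hfd : FiniteDimensional k ρ.asModule := ‹FiniteDimensional k W›
  have hbij := IsSimpleModule.algebraMap_end_bijective_of_isAlgClosed
    (A := MonoidAlgebra k G) (V := ρ.asModule) k
  let f' : ρ.asModule →ₗ[k] ρ.asModule := f
  -- By Schur's lemma, every linear map commutes with the endomorphisms of the simple module.
  let F : Module.End (Module.End (MonoidAlgebra k G) ρ.asModule) ρ.asModule :=
    { toFun := f'
      map_add' := f'.map_add
      map_smul' := fun c x => by
        obtain ⟨t, rfl⟩ := hbij.2 c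
        simp }
  let b := Module.finBasis k ρ.asModule
  obtain ⟨r, hr⟩ := jacobson_density F (Finset.univ.image b)
  refine ⟨r, ?_⟩
  have h : ∀ i, (ρ.asAlgebraHom r : ρ.asModule →ₗ[k] ρ.asModule) (b i) = f' (b i) := fun i =>
    (hr (b i) (Finset.mem_image_of_mem _ (Finset.mem_univ i))).symm
  exact b.ext h

theorem isIrreducible_iff {k G W : Type*} [Field k] [Group G] [AddCommGroup W] [Module k W]
    (ρ : Representation k G W) :
    ρ.IsIrreducible ↔ (∃ w : W, w ≠ 0) ∧
      ∀ N : Submodule k W, (∀ g, ∀ w ∈ N, ρ g w ∈ N) → (∃ w ∈ N, w ≠ 0) → N = ⊤ := by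
  constructor
  · intro h
    constructor
    · by_contra! h0
      refine bot_ne_top (α := Subrepresentation ρ) (Subrepresentation.toSubmodule_injective ?_)
      ext w
      rw [h0 w]
      exact iff_of_true (Submodule.zero_mem _) (Submodule.zero_mem _)
    · rintro N hN ⟨w, hw, hw0⟩
      rcases eq_bot_or_eq_top (⟨N, fun g v hv => hN g v hv⟩ : Subrepresentation ρ) with h1 | h1
      · have h2 : N = ⊥ := congrArg Subrepresentation.toSubmodule h1
        rw [h2] at hw
        exact (hw0 hw).elim
      · exact congrArg Subrepresentation.toSubmodule h1
  · rintro ⟨⟨w, hw⟩, h⟩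
    refine { exists_pair_ne := ⟨⊥, ⊤, fun h0 => hw ?_⟩, eq_bot_or_eq_top := fun N => ?_ }
    · have h1 : (⊥ : Submodule k W) = ⊤ := congrArg Subrepresentation.toSubmodule h0
      have h2 : w ∈ (⊥ : Submodule k W) := h1 ▸ Submodule.mem_top
      exact h2
    · by_cases h0 : ∃ w ∈ N.toSubmodule, w ≠ 0
      · exact Or.inr (Subrepresentation.toSubmodule_injective
          (h _ (fun g w hw => N.apply_mem_toSubmodule g hw) h0))
      · push Not at h0
        exact Or.inl (Subrepresentation.toSubmodule_injective ((Submodule.eq_bot_iff _).2 h0))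

/-- A nonzero finite dimensional representation contains an irreducible one. -/
theorem exists_irreducible_subrepresentation {k G U : Type*} [Field k] [Group G] [AddCommGroup U]
    [Module k U] [FiniteDimensional k U] (ρ : Representation k G U) (hU : ∃ u : U, u ≠ 0) :
    ∃ W : Subrepresentation ρ, W.toRepresentation.IsIrreducible := by
  let P : Set (Submodule k U) := {N | (∀ g, ∀ w ∈ N, ρ g w ∈ N) ∧ ∃ w ∈ N, w ≠ 0}
  obtain ⟨N, ⟨hN1, hN2⟩, hmin⟩ := (wellFounded_lt (α := Submodule k U)).has_min P
    ⟨⊤, fun _ _ _ => Submodule.mem_top, hU.imp fun u hu => ⟨Submodule.mem_top, hu⟩⟩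
  refine ⟨⟨N, fun g v hv => hN1 g v hv⟩, (isIrreducible_iff _).2 ⟨?_, ?_⟩⟩
  · obtain ⟨w, hw, hw0⟩ := hN2
    exact ⟨⟨w, hw⟩, fun h => hw0 (congrArg Subtype.val h)⟩
  · rintro K hK ⟨w, hw, hw0⟩
    have hle : K.map N.subtype ≤ N := Submodule.map_subtype_le N K
    have hP : K.map N.subtype ∈ P := by
      refine ⟨?_, ⟨w, ⟨w, hw, rfl⟩, fun h => hw0 (Subtype.ext h)⟩⟩
      rintro g _ ⟨y, hy, rfl⟩
      exact ⟨_, hK g y hy, rfl⟩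
    have h1 : K.map N.subtype = N := by
      by_contra hne
      exact hmin _ hP (lt_of_le_of_ne hle hne)
    rw [eq_top_iff]
    rintro ⟨x, hx⟩ -
    obtain ⟨y, hy, hyx⟩ := h1.ge hx
    have : y = ⟨x, hx⟩ := Subtype.ext hyx
    exact this ▸ hy

/-- The intertwining operators `W → U`, as a space of linear maps. -/
def intertwiners {k G W U : Type*} [Field k] [Group G] [AddCommGroup W] [Module k W]
    [AddCommGroup U] [Module k U] (σ : Representation k G W) (ρ : Representation k G U) :
    Submodule k (W →ₗ[k] U) where
  carrier := {m | ∀ g w, m (σ g w) = ρ g (m w)}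
  add_mem' ha hb g w := by simp [ha g w, hb g w]
  zero_mem' g w := by simp
  smul_mem' c m hm g w := by simp [hm g w]

/-- The evaluation map `W ⊗ Hom_G (W, U) → U`. -/
def evalIntertwiners {k G W U : Type*} [Field k] [Group G] [AddCommGroup W] [Module k W]
    [AddCommGroup U] [Module k U] (σ : Representation k G W) (ρ : Representation k G U) :
    W ⊗[k] intertwiners σ ρ →ₗ[k] U :=
  TensorProduct.lift (LinearMap.flip (intertwiners σ ρ).subtype)

@[simp]
theorem evalIntertwiners_tmul {k G W U : Type*} [Field k] [Group G] [AddCommGroup W] [Module k W]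
    [AddCommGroup U] [Module k U] (σ : Representation k G W) (ρ : Representation k G U)
    (w : W) (m : intertwiners σ ρ) : evalIntertwiners σ ρ (w ⊗ₜ m) = m.1 w := rfl

/-- The evaluation map is injective when `W` is irreducible: by Burnside's theorem, an operator of
the group algebra separates the members of a basis of `W`. -/
theorem evalIntertwiners_injective {k G W U : Type*} [Field k] [IsAlgClosed k] [Group G]
    [AddCommGroup W] [Module k W] [FiniteDimensional k W] [AddCommGroup U] [Module k U]
    (σ : Representation k G W) (ρ : Representation k G U) [σ.IsIrreducible] :
    Function.Injective (evalIntertwiners σ ρ) := by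
  rw [← LinearMap.ker_eq_bot, LinearMap.ker_eq_bot']
  intro t ht
  let b := Module.finBasis k W
  obtain ⟨m, rfl⟩ := TensorProduct.eq_repr_basis_left b t
  have hcomm : ∀ (r : MonoidAlgebra k G) (m : intertwiners σ ρ) (w : W),
      m.1 (σ.asAlgebraHom r w) = ρ.asAlgebraHom r (m.1 w) := by
    intro r m w
    induction r using MonoidAlgebra.induction_linear with
    | zero => simp
    | add x y hx hy => simp [hx, hy]
    | single g a => simp [Representation.asAlgebraHom_single, m.2 g w]
  have hm : ∀ j, m j = 0 := by
    intro j
    ext w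
    obtain ⟨r, hr⟩ := IsIrreducible.asAlgebraHom_surjective σ
      ((LinearMap.toSpanSingleton k W w) ∘ₗ b.coord j)
    have h1 := congrArg (ρ.asAlgebraHom r) ht
    rw [map_zero, Finsupp.sum, map_sum, map_sum] at h1
    simp only [evalIntertwiners_tmul, ← hcomm, hr] at h1
    rw [Finset.sum_eq_single j] at h1
    · simpa using h1
    · intro i _ hij
      simp [hij]
    · intro hj
      simp [Finsupp.notMem_support_iff.1 hj]
  simp [Finsupp.sum, hm]

/-- The action of `G₂` on `Hom_{G₁} (W, U)` when the actions of `G₁` and `G₂` on `U` commute. -/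
def onIntertwiners {k G₁ G₂ W U : Type*} [Field k] [Group G₁] [Group G₂] [AddCommGroup W]
    [Module k W] [AddCommGroup U] [Module k U] (σ : Representation k G₁ W)
    (ρ₁ : Representation k G₁ U) (ρ₂ : Representation k G₂ U)
    (hc : ∀ g h u, ρ₁ g (ρ₂ h u) = ρ₂ h (ρ₁ g u)) : Representation k G₂ (intertwiners σ ρ₁) where
  toFun h :=
    { toFun := fun m => ⟨ρ₂ h ∘ₗ m.1, fun g w => by simp [m.2 g w, hc]⟩
      map_add' := fun m m' => by ext; simp
      map_smul' := fun c m => by ext; simp }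
  map_one' := by ext; simp
  map_mul' h h' := by ext; simp

theorem eq_top_of_lTensor_surjective {k W M : Type*} [Field k] [AddCommGroup W] [Module k W]
    [Nontrivial W] [AddCommGroup M] [Module k M] (N : Submodule k M)
    (h : Function.Surjective (N.subtype.lTensor W)) : N = ⊤ := by
  rw [← Submodule.range_subtype N, LinearMap.range_eq_top]
  exact (Module.FaithfullyFlat.lTensor_surjective_iff_surjective k W _).1 h

/-- An irreducible representation of `G₁ × G₂` over an algebraically closed field is an external
tensor product `W ⊗ M` of irreducible representations: take `W ⊆ U` irreducible for `G₁`, and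
`M = Hom_{G₁} (W, U)`. -/
theorem exists_externalTensor {k G₁ G₂ U : Type*} [Field k] [IsAlgClosed k] [Group G₁] [Group G₂]
    [AddCommGroup U] [Module k U] [FiniteDimensional k U]
    (ρ₁ : Representation k G₁ U) (ρ₂ : Representation k G₂ U)
    (hc : ∀ g h u, ρ₁ g (ρ₂ h u) = ρ₂ h (ρ₁ g u)) (hU : ∃ u : U, u ≠ 0)
    (hirr : ∀ N : Submodule k U, (∀ g, ∀ u ∈ N, ρ₁ g u ∈ N) → (∀ h, ∀ u ∈ N, ρ₂ h u ∈ N) →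
      (∃ u ∈ N, u ≠ 0) → N = ⊤) :
    ∃ W : Subrepresentation ρ₁, W.toRepresentation.IsIrreducible ∧
      (onIntertwiners W.toRepresentation ρ₁ ρ₂ hc).IsIrreducible ∧
      Function.Bijective (evalIntertwiners W.toRepresentation ρ₁) := by
  obtain ⟨W, hW⟩ := exists_irreducible_subrepresentation ρ₁ hU
  obtain ⟨w₀, hw₀⟩ := ((isIrreducible_iff _).1 hW).1
  set σ := W.toRepresentation with hσ
  have hinj := evalIntertwiners_injective σ ρ₁
  -- The image of `W ⊗ N` is everything, for each nonzero `G₂`-submodule `N` of `Hom_{G₁} (W, U)`.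
  have key : ∀ N : Submodule k (intertwiners σ ρ₁),
      (∀ h, ∀ m ∈ N, onIntertwiners σ ρ₁ ρ₂ hc h m ∈ N) → (∃ m ∈ N, m ≠ 0) →
      Function.Surjective (evalIntertwiners σ ρ₁ ∘ₗ N.subtype.lTensor W.toSubmodule) := by
    rintro N hN ⟨m, hm, hm0⟩
    rw [← LinearMap.range_eq_top]
    have hmem : ∀ (w : W.toSubmodule) (n : N), n.1.1 w ∈
        LinearMap.range (evalIntertwiners σ ρ₁ ∘ₗ N.subtype.lTensor W.toSubmodule) :=
      fun w n => ⟨w ⊗ₜ n, rfl⟩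
    refine hirr _ ?_ ?_ ?_
    · rintro g _ ⟨t, rfl⟩
      induction t with
      | zero => simp
      | add x y hx hy => rw [map_add, map_add]; exact Submodule.add_mem _ hx hy
      | tmul w n =>
        have h1 : ρ₁ g (n.1.1 w) = n.1.1 (σ g w) := (n.1.2 g w).symm
        change ρ₁ g (n.1.1 w) ∈ _
        rw [h1]
        exact hmem _ n
    · rintro h _ ⟨t, rfl⟩
      induction t with
      | zero => simp
      | add x y hx hy => rw [map_add, map_add]; exact Submodule.add_mem _ hx hy
      | tmul w n => exact hmem w ⟨_, hN h n.1 n.2⟩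
    · by_contra! h0
      refine hm0 (Subtype.ext (LinearMap.ext fun w => h0 _ (hmem w ⟨m, hm⟩)))
  refine ⟨W, hW, (isIrreducible_iff _).2 ⟨?_, ?_⟩, hinj, ?_⟩
  · refine ⟨⟨W.toSubmodule.subtype, fun g w => rfl⟩, fun h => hw₀ (Subtype.ext ?_)⟩
    exact LinearMap.congr_fun (congrArg Subtype.val h) w₀
  · intro N hN hN0
    have hs := key N hN hN0
    have hsub : Function.Surjective (N.subtype.lTensor W.toSubmodule) := by
      intro t
      obtain ⟨s, hs⟩ := hs (evalIntertwiners σ ρ₁ t)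
      exact ⟨s, hinj hs⟩
    have : Nontrivial W.toSubmodule := ⟨w₀, 0, hw₀⟩
    exact eq_top_of_lTensor_surjective N hsub
  · intro u
    obtain ⟨t, ht⟩ := key ⊤ (fun _ _ _ => Submodule.mem_top)
      ⟨⟨W.toSubmodule.subtype, fun g w => rfl⟩, Submodule.mem_top, fun h => hw₀ (Subtype.ext
        (LinearMap.congr_fun (congrArg Subtype.val h) w₀))⟩ u
    exact ⟨_, ht⟩

/-- The decomposition of an irreducible representation of `G₁ × G₂` as an external tensor product,
with abstract factors. -/
theorem exists_externalTensor_equiv {k G₁ G₂ : Type*} {U : Type u} [Field k] [IsAlgClosed k]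
    [Group G₁] [Group G₂] [AddCommGroup U] [Module k U] [FiniteDimensional k U]
    (ρ₁ : Representation k G₁ U) (ρ₂ : Representation k G₂ U)
    (hc : ∀ g h u, ρ₁ g (ρ₂ h u) = ρ₂ h (ρ₁ g u)) (hU : ∃ u : U, u ≠ 0)
    (hirr : ∀ N : Submodule k U, (∀ g, ∀ u ∈ N, ρ₁ g u ∈ N) → (∀ h, ∀ u ∈ N, ρ₂ h u ∈ N) →
      (∃ u ∈ N, u ≠ 0) → N = ⊤) :
    ∃ (W M : Type u) (_ : AddCommGroup W) (_ : Module k W) (_ : FiniteDimensional k W)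
      (_ : AddCommGroup M) (_ : Module k M) (_ : FiniteDimensional k M)
      (τ : Representation k G₁ W) (τ' : Representation k G₂ M) (T : W ⊗[k] M ≃ₗ[k] U),
      τ.IsIrreducible ∧ τ'.IsIrreducible ∧
      (∀ g w m, ρ₁ g (T (w ⊗ₜ m)) = T (τ g w ⊗ₜ m)) ∧
      (∀ h w m, ρ₂ h (T (w ⊗ₜ m)) = T (w ⊗ₜ τ' h m)) := by
  obtain ⟨W, hW, hM, hT⟩ := exists_externalTensor ρ₁ ρ₂ hc hU hirr
  exact ⟨W.toSubmodule, intertwiners W.toRepresentation ρ₁, inferInstance, inferInstance,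
    inferInstance, inferInstance, inferInstance, inferInstance, W.toRepresentation,
    onIntertwiners W.toRepresentation ρ₁ ρ₂ hc, LinearEquiv.ofBijective _ hT, hW, hM,
    fun g w m => (m.2 g w).symm, fun h w m => rfl⟩

end Representation

/-! ### The wedge product of alternating forms -/

namespace AlternatingMap

variable {k M M' : Type*} [Field k] [AddCommGroup M] [Module k M] [AddCommGroup M'] [Module k M']
  {m n : ℕ}

/-- The wedge product of an `m`-form and an `n`-form, normalised as the plain sum over all
permutations, which is `m! n!` times the sum over shuffles. -/
def wedge (φ : M [⋀^Fin m]→ₗ[k] k) (ψ : M [⋀^Fin n]→ₗ[k] k) : M [⋀^Fin (m + n)]→ₗ[k] k :=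
  (MultilinearMap.alternatization ((LinearMap.mul' k k).compMultilinearMap
    (MultilinearMap.domCoprod φ.toMultilinearMap ψ.toMultilinearMap))).domDomCongr finSumFinEquiv

theorem wedge_apply (φ : M [⋀^Fin m]→ₗ[k] k) (ψ : M [⋀^Fin n]→ₗ[k] k) (v : Fin (m + n) → M) :
    wedge φ ψ v = ∑ s : Equiv.Perm (Fin m ⊕ Fin n), (Equiv.Perm.sign s : ℤ) •
      (φ (fun i => v (finSumFinEquiv (s (Sum.inl i)))) *
        ψ (fun j => v (finSumFinEquiv (s (Sum.inr j))))) := by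
  rw [wedge, domDomCongr_apply, MultilinearMap.alternatization_apply]
  rfl

theorem finset_sum_apply {ι : Type*} (s : Finset ι) (f : ι → M [⋀^Fin n]→ₗ[k] k) (v : Fin n → M) :
    (∑ i ∈ s, f i) v = ∑ i ∈ s, f i v := by
  classical
  induction s using Finset.induction_on with
  | empty => simp
  | insert i s hi h => rw [Finset.sum_insert hi, Finset.sum_insert hi, AlternatingMap.add_apply, h]

theorem wedge_compLinearMap (φ : M [⋀^Fin m]→ₗ[k] k) (ψ : M [⋀^Fin n]→ₗ[k] k) (f : M' →ₗ[k] M) :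
    (wedge φ ψ).compLinearMap f = wedge (φ.compLinearMap f) (ψ.compLinearMap f) := by
  ext v
  simp [wedge_apply]

/-- The wedge product as a bilinear map. -/
def wedgeₗ : (M [⋀^Fin m]→ₗ[k] k) →ₗ[k] (M [⋀^Fin n]→ₗ[k] k) →ₗ[k] (M [⋀^Fin (m + n)]→ₗ[k] k) :=
  LinearMap.mk₂ k wedge
    (fun a b c => by ext v; simp [wedge_apply, add_mul, Finset.sum_add_distrib])
    (fun a b c => by ext v; simp [wedge_apply, mul_assoc, Finset.mul_sum, mul_left_comm])
    (fun a b c => by ext v; simp [wedge_apply, mul_add, Finset.sum_add_distrib])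
    (fun a b c => by ext v; simp [wedge_apply, mul_left_comm, Finset.mul_sum])

/-- On vectors adapted to a direct sum decomposition, the wedge product of forms pulled back from
the two summands is the product of the values, up to the number of permutations which preserve
the blocks. -/
theorem exists_wedge_append_eq [CharZero k] (m n : ℕ) : ∃ N : k, N ≠ 0 ∧
    ∀ (φ : M [⋀^Fin m]→ₗ[k] k) (ψ : M [⋀^Fin n]→ₗ[k] k) (x : Fin m → M) (y : Fin n → M),
      (∀ (z : Fin n → M) (j : Fin n), z j ∈ Set.range x → ψ z = 0) →
      wedge φ ψ (fun i => Sum.elim x y (finSumFinEquiv.symm i)) = N * (φ x * ψ y) := by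
  classical
  refine ⟨((Finset.univ.filter fun s : Equiv.Perm (Fin m ⊕ Fin n) =>
      s ∈ (Equiv.Perm.sumCongrHom (Fin m) (Fin n)).range).card : k), ?_, ?_⟩
  · rw [Nat.cast_ne_zero, Finset.card_ne_zero]
    exact ⟨1, Finset.mem_filter.2 ⟨Finset.mem_univ _, Subgroup.one_mem _⟩⟩
  · intro φ ψ x y hψ
    simp only [wedge_apply, Equiv.symm_apply_apply]
    rw [← Finset.sum_filter_add_sum_filter_not Finset.univ
      (fun s => s ∈ (Equiv.Perm.sumCongrHom (Fin m) (Fin n)).range)]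
    rw [Finset.sum_eq_card_nsmul (b := φ x * ψ y), Finset.sum_eq_zero]
    · simp
    · intro s hs
      -- A permutation which does not preserve the blocks feeds some `x i` to `ψ`.
      have hex : ∃ j i, s (Sum.inr j) = Sum.inl i := by
        by_contra! hne
        refine (Finset.mem_filter.1 hs).2
          (Equiv.Perm.mem_sumCongrHom_range_of_perm_mapsTo_inl
            ((Equiv.Perm.perm_mapsTo_inl_iff_mapsTo_inr s).2 ?_))
        rintro _ ⟨j, rfl⟩
        rcases h : s (Sum.inr j) with i | i
        · exact (hne j i h).elim
        · exact ⟨i, rfl⟩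
      obtain ⟨j, i, hji⟩ := hex
      rw [hψ _ j ⟨i, by simp [hji]⟩, mul_zero, smul_zero]
    · intro s hs
      obtain ⟨⟨a, b⟩, rfl⟩ := (Finset.mem_filter.1 hs).2
      have ha := φ.map_perm x a
      have hb := ψ.map_perm y b
      simp only [Equiv.Perm.sumCongrHom_apply, Equiv.sumCongr_apply, Sum.map_inl, Sum.map_inr,
        Sum.elim_inl, Sum.elim_inr, Equiv.Perm.sign_sumCongr]
      simp only [Function.comp_def] at ha hb
      rw [ha, hb]
      rcases Int.units_eq_one_or (Equiv.Perm.sign a) with h1 | h1 <;>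
        rcases Int.units_eq_one_or (Equiv.Perm.sign b) with h2 | h2 <;> simp [h1, h2]

end AlternatingMap

/-! ### Homology of products and powers -/

namespace AbelianVariety

variable {A B C : AbelianVariety.{u}}

@[simp]
theorem H₁map_tmul (f : A.Lie →ₗ[ℂ] B.Lie) (c : ℂ) (x : A.Lie) :
    H₁map f (c ⊗ₜ x) = c ⊗ₜ f x := rfl

theorem H₁map_comp (g : B.Lie →ₗ[ℂ] C.Lie) (f : A.Lie →ₗ[ℂ] B.Lie) :
    H₁map (g ∘ₗ f) = H₁map g ∘ₗ H₁map f := by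
  apply TensorProduct.AlgebraTensorModule.ext
  intro c x
  rfl

theorem H₁map_apply_apply (g : B.Lie →ₗ[ℂ] C.Lie) (f : A.Lie →ₗ[ℂ] B.Lie) (x : A.H₁) :
    H₁map g (H₁map f x) = H₁map (g ∘ₗ f) x := by
  rw [H₁map_comp]; rfl

@[simp]
theorem H₁map_id : H₁map (LinearMap.id : A.Lie →ₗ[ℂ] A.Lie) = LinearMap.id := by
  apply TensorProduct.AlgebraTensorModule.ext
  intro c x
  rfl

@[simp]
theorem H₁map_zero : H₁map (0 : A.Lie →ₗ[ℂ] B.Lie) = 0 := by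
  apply TensorProduct.AlgebraTensorModule.ext
  intro c x
  simp

theorem H₁map_add (f g : A.Lie →ₗ[ℂ] B.Lie) : H₁map (f + g) = H₁map f + H₁map g := by
  apply TensorProduct.AlgebraTensorModule.ext
  intro c x
  simp [TensorProduct.tmul_add]

theorem H₁map_sum {ι : Type*} (s : Finset ι) (f : ι → A.Lie →ₗ[ℂ] B.Lie) :
    H₁map (∑ i ∈ s, f i) = ∑ i ∈ s, H₁map (f i) := by
  apply TensorProduct.AlgebraTensorModule.ext
  intro c x
  simp [TensorProduct.tmul_sum]

theorem proj_comp_single (A : AbelianVariety.{u}) (d : ℕ) (i j : Fin d) :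
    A.proj d i ∘ₗ A.single d j = if i = j then LinearMap.id else 0 := by
  ext x
  rw [show (A.proj d i ∘ₗ A.single d j) x = (Pi.single j x : Fin d → A.Lie) i from rfl]
  split_ifs with h
  · subst h; simp
  · simp [Pi.single_eq_of_ne h]

theorem H₁map_proj_single (A : AbelianVariety.{u}) (d : ℕ) (i j : Fin d) (x : A.H₁) :
    H₁map (A.proj d i) (H₁map (A.single d j) x) = if i = j then x else 0 := by
  rw [H₁map_apply_apply, proj_comp_single]
  split_ifs <;> simp

theorem sum_single_proj (A : AbelianVariety.{u}) (d : ℕ) :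
    ∑ i, A.single d i ∘ₗ A.proj d i = LinearMap.id := by
  refine LinearMap.ext fun x => ?_
  rw [LinearMap.sum_apply]
  exact Finset.univ_sum_single (M := fun _ : Fin d => A.Lie) x

theorem sum_H₁map_single_proj (A : AbelianVariety.{u}) (d : ℕ) (x : (A.pow d).H₁) :
    ∑ i, H₁map (A.single d i) (H₁map (A.proj d i) x) = x := by
  have h := LinearMap.congr_fun (congrArg H₁map (sum_single_proj A d)) x
  rw [H₁map_sum, LinearMap.sum_apply] at h
  simpa only [H₁map_apply_apply, H₁map_id, LinearMap.id_apply] using h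

theorem pow_H₁_ext {d : ℕ} {x y : (A.pow d).H₁}
    (h : ∀ i, H₁map (A.proj d i) x = H₁map (A.proj d i) y) : x = y := by
  rw [← sum_H₁map_single_proj A d x, ← sum_H₁map_single_proj A d y]
  simp [h]

theorem H₁map_proj_diag {d : ℕ} (g : Module.End ℂ A.H₁) (i : Fin d) (x : (A.pow d).H₁) :
    H₁map (A.proj d i) (A.diag d g x) = g (H₁map (A.proj d i) x) := by
  simp [diag, LinearMap.sum_apply, H₁map_proj_single]

theorem H₁map_fst_inl (x : A.H₁) : H₁map (fst A B) (H₁map (inl A B) x) = x := by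
  rw [H₁map_apply_apply, show fst A B ∘ₗ inl A B = LinearMap.id from LinearMap.fst_comp_inl ..]
  simp

theorem H₁map_snd_inr (x : B.H₁) : H₁map (snd A B) (H₁map (inr A B) x) = x := by
  rw [H₁map_apply_apply, show snd A B ∘ₗ inr A B = LinearMap.id from LinearMap.snd_comp_inr ..]
  simp

theorem H₁map_fst_inr (x : B.H₁) : H₁map (fst A B) (H₁map (inr A B) x) = 0 := by
  rw [H₁map_apply_apply, show fst A B ∘ₗ inr A B = 0 from LinearMap.fst_comp_inr ..]
  simp

theorem H₁map_snd_inl (x : A.H₁) : H₁map (snd A B) (H₁map (inl A B) x) = 0 := by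
  rw [H₁map_apply_apply, show snd A B ∘ₗ inl A B = 0 from LinearMap.snd_comp_inl ..]
  simp

theorem inl_fst_add_inr_snd (x : (A.prod B).H₁) :
    H₁map (inl A B) (H₁map (fst A B) x) + H₁map (inr A B) (H₁map (snd A B) x) = x := by
  rw [H₁map_apply_apply, H₁map_apply_apply, ← LinearMap.add_apply, ← H₁map_add,
    show inl A B ∘ₗ fst A B + inr A B ∘ₗ snd A B = LinearMap.id from ?_]
  · simp
  · refine LinearMap.ext fun x => ?_
    exact Prod.ext (add_zero _) (zero_add _)

theorem prod_H₁_ext {x y : (A.prod B).H₁} (h₁ : H₁map (fst A B) x = H₁map (fst A B) y)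
    (h₂ : H₁map (snd A B) x = H₁map (snd A B) y) : x = y := by
  rw [← inl_fst_add_inr_snd x, ← inl_fst_add_inr_snd y, h₁, h₂]

theorem H₁map_fst_blockDiag (a : Module.End ℂ A.H₁) (b : Module.End ℂ B.H₁)
    (x : (A.prod B).H₁) : H₁map (fst A B) (blockDiag A B a b x) = a (H₁map (fst A B) x) := by
  simp [blockDiag, H₁map_fst_inl, H₁map_fst_inr]

theorem H₁map_snd_blockDiag (a : Module.End ℂ A.H₁) (b : Module.End ℂ B.H₁)
    (x : (A.prod B).H₁) : H₁map (snd A B) (blockDiag A B a b x) = b (H₁map (snd A B) x) := by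
  simp [blockDiag, H₁map_snd_inl, H₁map_snd_inr]

theorem inv_apply_self (g : A.GLH₁) (x : A.H₁) : g⁻¹ (g x) = x := g.symm_apply_apply x

theorem apply_inv_self (g : A.GLH₁) (x : A.H₁) : g (g⁻¹ x) = x := g.apply_symm_apply x

/-! ### The rational structure on homology -/

/-- A `ℂ`-linear map on `H₁(A, ℂ)` is determined by its values on the lattice. -/
theorem H₁_hom_ext {M : Type*} [AddCommGroup M] [Module ℂ M] {f g : A.H₁ →ₗ[ℂ] M}
    (h : ∀ x ∈ A.lattice, f (1 ⊗ₜ x) = g (1 ⊗ₜ x)) : f = g := by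
  let : Module ℝ M := Module.compHom M (algebraMap ℝ ℂ)
  have : IsScalarTower ℝ ℂ M := IsScalarTower.of_compHom ℝ ℂ M
  let ι : A.Lie →ₗ[ℝ] A.H₁ := TensorProduct.mk ℝ ℂ A.Lie 1
  have h1 : (f.restrictScalars ℝ) ∘ₗ ι = (g.restrictScalars ℝ) ∘ₗ ι :=
    LinearMap.ext_on (IsZLattice.span_top (K := ℝ) (L := A.lattice)) h
  apply TensorProduct.AlgebraTensorModule.ext
  intro c x
  have h2 : c ⊗ₜ[ℝ] x = c • ((1 : ℂ) ⊗ₜ[ℝ] x) := by simp [TensorProduct.smul_tmul']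
  rw [h2, map_smul, map_smul]
  exact congrArg (c • ·) (LinearMap.congr_fun h1 x)

theorem span_lattice (A : AbelianVariety.{u}) :
    Submodule.span ℂ {y : A.H₁ | ∃ x ∈ A.lattice, y = 1 ⊗ₜ x} = ⊤ := by
  set N := Submodule.span ℂ {y : A.H₁ | ∃ x ∈ A.lattice, y = 1 ⊗ₜ x} with hN
  have h : N.mkQ = 0 := H₁_hom_ext fun x hx => by
    have h1 : (1 : ℂ) ⊗ₜ[ℝ] x ∈ N := Submodule.subset_span ⟨x, hx, rfl⟩
    simpa using h1
  simpa using congrArg LinearMap.ker h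

/-- A linear form on `H₁(A, ℂ)` which takes rational values on the lattice, that is, an element of
`H¹(A, ℚ)`. -/
def IsRational (A : AbelianVariety.{u}) (l : A.H₁ →ₗ[ℂ] ℂ) : Prop :=
  ∀ w ∈ A.lattice, ∃ q : ℚ, l (1 ⊗ₜ w) = q

theorem IsRational.comp_H₁map {l : B.H₁ →ₗ[ℂ] ℂ} (hl : B.IsRational l) {f : A.Lie →ₗ[ℂ] B.Lie}
    (hf : ∀ x ∈ A.lattice, f x ∈ B.lattice) : A.IsRational (l ∘ₗ H₁map f) :=
  fun w hw => hl _ (hf w hw)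

/-- The rational linear forms separate the points of `H₁(A, ℂ)`: take the coordinates with respect
to a basis of the lattice. -/
theorem eq_of_isRational {x y : A.H₁} (h : ∀ l, A.IsRational l → l x = l y) : x = y := by
  let b := Module.Free.chooseBasis ℤ A.lattice
  let b' := (b.ofZLatticeBasis ℝ A.lattice).baseChange ℂ
  refine b'.ext_elem fun i => h (b'.coord i) fun w hw => ?_
  refine ⟨(b.repr ⟨w, hw⟩ i : ℤ), ?_⟩
  have h1 := b.ofZLatticeBasis_repr_apply ℝ A.lattice ⟨w, hw⟩ i
  simp [b', Module.Basis.baseChange_repr_tmul, h1]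

/-! ### Pulling back forms -/

theorem IsConjugate.compLinearMap {n : ℕ} {σ : ℂ ≃+* ℂ} {φ ψ : B.Coh n}
    (h : B.IsConjugate σ φ ψ) {f : A.Lie →ₗ[ℂ] B.Lie} (hf : ∀ x ∈ A.lattice, f x ∈ B.lattice) :
    A.IsConjugate σ (φ.compLinearMap (H₁map f)) (ψ.compLinearMap (H₁map f)) :=
  fun l hl => h (fun i => f (l i)) fun i => hf _ (hl i)

theorem IsHolomorphicForm.compLinearMap {n : ℕ} {φ : B.Coh n} (h : B.IsHolomorphicForm φ)
    (f : A.Lie →ₗ[ℂ] B.Lie) : A.IsHolomorphicForm (φ.compLinearMap (H₁map f)) := by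
  obtain ⟨ω, hω⟩ := h
  exact ⟨ω.compLinearMap f, fun x => hω fun i => f (x i)⟩

theorem IsConjugate.wedge {m n : ℕ} {σ : ℂ ≃+* ℂ} {φ φ' : A.Coh m} {ψ ψ' : A.Coh n}
    (h : A.IsConjugate σ φ φ') (h' : A.IsConjugate σ ψ ψ') :
    A.IsConjugate σ (φ.wedge ψ) (φ'.wedge ψ') := by
  intro l hl
  rw [AlternatingMap.wedge_apply, AlternatingMap.wedge_apply, map_sum]
  refine Finset.sum_congr rfl fun s _ => ?_
  rw [map_zsmul, map_mul, h _ fun i => hl _, h' _ fun i => hl _]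

theorem IsHolomorphicForm.wedge {m n : ℕ} {φ : A.Coh m} {ψ : A.Coh n}
    (h : A.IsHolomorphicForm φ) (h' : A.IsHolomorphicForm ψ) :
    A.IsHolomorphicForm (φ.wedge ψ) := by
  obtain ⟨ω, hω⟩ := h
  obtain ⟨ω', hω'⟩ := h'
  refine ⟨ω.wedge ω', fun x => ?_⟩
  rw [AlternatingMap.wedge_apply, AlternatingMap.wedge_apply]
  exact Finset.sum_congr rfl fun s _ => by rw [hω, hω']

theorem compLinearMap_injective {n : ℕ} {f : A.Lie →ₗ[ℂ] B.Lie} {s : B.Lie →ₗ[ℂ] A.Lie}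
    (h : f ∘ₗ s = LinearMap.id) {φ ψ : B.Coh n}
    (hφ : φ.compLinearMap (H₁map f) = ψ.compLinearMap (H₁map f)) : φ = ψ := by
  ext v
  have h1 := congrFun (congrArg DFunLike.coe hφ) fun i => H₁map s (v i)
  simpa [H₁map_apply_apply, h] using h1

/-- The map `B ^ e → A ^ d` which is given by a map `π : B → A` and a choice of `d` of the `e`
coordinates. -/
def powMap (π : B.Lie →ₗ[ℂ] A.Lie) {d e : ℕ} (c : Fin d → Fin e) :
    (B.pow e).Lie →ₗ[ℂ] (A.pow d).Lie :=
  LinearMap.pi fun i => π ∘ₗ B.proj e (c i)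

theorem proj_comp_powMap (π : B.Lie →ₗ[ℂ] A.Lie) {d e : ℕ} (c : Fin d → Fin e) (i : Fin d) :
    A.proj d i ∘ₗ powMap π c = π ∘ₗ B.proj e (c i) := rfl

theorem powMap_mem_lattice {π : B.Lie →ₗ[ℂ] A.Lie} (hπ : ∀ x ∈ B.lattice, π x ∈ A.lattice)
    {d e : ℕ} (c : Fin d → Fin e) : ∀ x ∈ (B.pow e).lattice, powMap π c x ∈ (A.pow d).lattice :=
  fun _ hx i _ => hπ _ (hx (c i) trivial)

/-- The section of `powMap π c` which is given by a section `s` of `π`. -/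
def powSection (s : A.Lie →ₗ[ℂ] B.Lie) {d e : ℕ} (c : Fin d → Fin e) :
    (A.pow d).Lie →ₗ[ℂ] (B.pow e).Lie :=
  ∑ i, B.single e (c i) ∘ₗ s ∘ₗ A.proj d i

theorem powMap_comp_powSection (π : B.Lie →ₗ[ℂ] C.Lie) (s : A.Lie →ₗ[ℂ] B.Lie) {d d' e : ℕ}
    (c : Fin d → Fin e) (c' : Fin d' → Fin e) (i : Fin d') :
    C.proj d' i ∘ₗ powMap π c' ∘ₗ powSection s c =
      ∑ j, if c' i = c j then π ∘ₗ s ∘ₗ A.proj d j else 0 := by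
  rw [← LinearMap.comp_assoc, proj_comp_powMap, powSection, ← LinearMap.compRight_apply ℂ, map_sum]
  refine Finset.sum_congr rfl fun j _ => ?_
  rw [LinearMap.compRight_apply, LinearMap.comp_assoc, ← LinearMap.comp_assoc _ _ (B.proj e (c' i)),
    proj_comp_single]
  split_ifs
  · rfl
  · rw [LinearMap.zero_comp, LinearMap.comp_zero]

theorem pow_Lie_hom_ext {d : ℕ} {f g : B.Lie →ₗ[ℂ] (A.pow d).Lie}
    (h : ∀ i, A.proj d i ∘ₗ f = A.proj d i ∘ₗ g) : f = g :=
  LinearMap.ext fun x => funext fun i => LinearMap.congr_fun (h i) x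

theorem powMap_powSection_eq_id {π : B.Lie →ₗ[ℂ] A.Lie} {s : A.Lie →ₗ[ℂ] B.Lie}
    (h : π ∘ₗ s = LinearMap.id) {d e : ℕ} {c : Fin d → Fin e} (hc : Function.Injective c) :
    powMap π c ∘ₗ powSection s c = LinearMap.id := by
  refine pow_Lie_hom_ext (B := A.pow d) fun i => ?_
  rw [powMap_comp_powSection, Finset.sum_eq_single i]
  · rw [if_pos rfl, ← LinearMap.comp_assoc, h]; rfl
  · intro j _ hj
    rw [if_neg fun h => hj (hc h).symm]
  · simp

theorem powMap_powSection_eq_zero {π : B.Lie →ₗ[ℂ] C.Lie} {s : A.Lie →ₗ[ℂ] B.Lie}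
    (h : π ∘ₗ s = 0) {d d' e : ℕ} (c : Fin d → Fin e) (c' : Fin d' → Fin e) :
    powMap π c' ∘ₗ powSection s c = 0 := by
  refine pow_Lie_hom_ext (B := A.pow d) fun i => ?_
  rw [powMap_comp_powSection, LinearMap.comp_zero]
  refine Finset.sum_eq_zero fun j _ => ?_
  rw [← LinearMap.comp_assoc, h, LinearMap.zero_comp, ite_self]

/-- Pulling back forms along `powMap π c` is compatible with the actions of `g` and `a` if `π`
intertwines them. -/
theorem act_compLinearMap {π : B.Lie →ₗ[ℂ] A.Lie} {g : B.GLH₁} {a : A.GLH₁}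
    (h : ∀ x, H₁map π (g x) = a (H₁map π x)) {n d e : ℕ} (c : Fin d → Fin e)
    (φ : (A.pow d).Coh n) :
    B.act g (φ.compLinearMap (H₁map (powMap π c))) =
      (A.act a φ).compLinearMap (H₁map (powMap π c)) := by
  have h' : ∀ x, H₁map π (g⁻¹ x) = a⁻¹ (H₁map π x) := fun x => by
    rw [← inv_apply_self a (H₁map π (g⁻¹ x)), ← h, apply_inv_self]
  have key : ∀ x, H₁map (powMap π c) (B.diag e (g⁻¹ : B.GLH₁).toLinearMap x) =
      A.diag d (a⁻¹ : A.GLH₁).toLinearMap (H₁map (powMap π c) x) := by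
    intro x
    refine pow_H₁_ext fun i => ?_
    rw [H₁map_proj_diag, H₁map_apply_apply, H₁map_apply_apply, proj_comp_powMap,
      ← H₁map_apply_apply, ← H₁map_apply_apply, H₁map_proj_diag]
    exact h' _
  ext v
  exact congrArg φ (funext fun i => key (v i))

theorem act_wedge {n m d : ℕ} (g : A.GLH₁) (φ : (A.pow d).Coh n) (ψ : (A.pow d).Coh m) :
    A.act g (φ.wedge ψ) = (A.act g φ).wedge (A.act g ψ) :=
  AlternatingMap.wedge_compLinearMap φ ψ _

/-- `act` as a linear map. -/
def actₗ (A : AbelianVariety.{u}) (d n : ℕ) (g : A.GLH₁) :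
    (A.pow d).Coh n →ₗ[ℂ] (A.pow d).Coh n where
  toFun := A.act g
  map_add' _ _ := rfl
  map_smul' _ _ := rfl

theorem actₗ_apply {d n : ℕ} (g : A.GLH₁) (φ : (A.pow d).Coh n) : A.actₗ d n g φ = A.act g φ := rfl

/-! ### Representations realised in the cohomology -/

/-- The map `E` realises the representation `ρ` of a subgroup of `GL(H₁(A, ℂ))` on an
`L(A)`-submodule of `H ^ c (A ^ d)`, all conjugates of which contain nonzero `(c, 0)`-forms. -/
structure Realises (A : AbelianVariety.{u}) {U : Type} [AddCommGroup U] [Module ℂ U]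
    {G : Subgroup A.GLH₁} (ρ : Representation ℂ G U) {c d : ℕ} (E : U →ₗ[ℂ] (A.pow d).Coh c) :
    Prop where
  injective : Function.Injective E
  lefschetz : ∀ g ∈ A.lefschetzGroup, ∀ u, ∃ u', A.act g (E u) = E u'
  equivariant : ∀ (g : G) (u : U), E (ρ g u) = A.act (g : A.GLH₁) (E u)
  holomorphic : ∀ σ : ℂ ≃+* ℂ, ∃ u ψ, (A.pow d).IsConjugate σ (E u) ψ ∧ ψ ≠ 0 ∧
    (A.pow d).IsHolomorphicForm ψ

/-- Weak self-domination in terms of embeddings `E : U → H ^ c (A ^ d)` rather than of their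
images. -/
theorem isWeaklySelfDominated_iff (A : AbelianVariety.{u}) :
    A.IsWeaklySelfDominated ↔ ∀ (U : Type) [AddCommGroup U] [Module ℂ U] [FiniteDimensional ℂ U]
      (ρ : Representation ℂ A.derivedHodgeGroup U),
      A.IsAlgebraicRep ρ → ρ.IsIrreducible → (∃ g v, ρ g v ≠ v) →
      ∃ c d : ℕ, 0 < c ∧ 0 < d ∧ ∃ E : U →ₗ[ℂ] (A.pow d).Coh c, A.Realises ρ E := by
  constructor
  · intro h U _ _ _ ρ h1 h2 h3
    obtain ⟨c, d, hc, hd, V, hV, ⟨e, he⟩, hσ⟩ := h U ρ h1 h2 h3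
    refine ⟨c, d, hc, hd, V.subtype ∘ₗ e.toLinearMap, ?_, ?_, ?_, ?_⟩
    · exact V.subtype_injective.comp e.injective
    · intro g hg u
      exact ⟨e.symm ⟨_, hV g hg _ (e u).2⟩, by simp⟩
    · exact he
    · intro σ
      obtain ⟨ψ, ⟨φ, hφ, hc⟩, h0, hh⟩ := hσ σ
      exact ⟨e.symm ⟨φ, hφ⟩, ψ, by simpa using hc, h0, hh⟩
  · intro h U _ _ _ ρ h1 h2 h3
    obtain ⟨c, d, hc, hd, E, hE⟩ := h U ρ h1 h2 h3
    refine ⟨c, d, hc, hd, LinearMap.range E, ?_, ⟨LinearEquiv.ofInjective E hE.injective, ?_⟩, ?_⟩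
    · rintro g hg _ ⟨u, rfl⟩
      obtain ⟨u', hu'⟩ := hE.lefschetz g hg u
      exact ⟨u', hu'.symm⟩
    · exact hE.equivariant
    · intro σ
      obtain ⟨u, ψ, hc, h0, hh⟩ := hE.holomorphic σ
      exact ⟨ψ, ⟨E u, ⟨u, rfl⟩, hc⟩, h0, hh⟩

/-- For a weakly self-dominated `A`, the trivial irreducible representations are realised as
well, namely by constants in degree `0`. -/
theorem IsWeaklySelfDominated.exists_realises (h : A.IsWeaklySelfDominated) {U : Type}
    [AddCommGroup U] [Module ℂ U] [FiniteDimensional ℂ U]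
    (ρ : Representation ℂ A.derivedHodgeGroup U) (h1 : A.IsAlgebraicRep ρ)
    (h2 : ρ.IsIrreducible) :
    ∃ c d : ℕ, ((∃ g v, ρ g v ≠ v) → 0 < c ∧ 0 < d) ∧ ∃ E : U →ₗ[ℂ] (A.pow d).Coh c,
      A.Realises ρ E := by
  by_cases h3 : ∃ g v, ρ g v ≠ v
  · obtain ⟨c, d, hc, hd, hE⟩ := (isWeaklySelfDominated_iff A).1 h U ρ h1 h2 h3
    exact ⟨c, d, fun _ => ⟨hc, hd⟩, hE⟩
  · refine ⟨0, 0, fun h => (h3 h).elim, ?_⟩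
    push Not at h3
    obtain ⟨⟨w, hw⟩, hirr⟩ := (Representation.isIrreducible_iff ρ).1 h2
    have hspan : Submodule.span ℂ {w} = ⊤ :=
      hirr _ (fun g x hx => by rwa [h3]) ⟨w, Submodule.mem_span_singleton_self w, hw⟩
    let e : ℂ ≃ₗ[ℂ] U := (LinearEquiv.toSpanNonzeroSingleton ℂ U w hw).trans
      ((LinearEquiv.ofEq _ _ hspan).trans Submodule.topEquiv)
    let K : ℂ →ₗ[ℂ] (A.pow 0).Coh 0 :=
      (AlternatingMap.constLinearEquivOfIsEmpty (R' := ℂ) (M'' := (A.pow 0).H₁) (N'' := ℂ)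
        (ι := Fin 0)).toLinearMap
    have hK : ∀ (c : ℂ) (v : Fin 0 → (A.pow 0).H₁), K c v = c := fun c v => rfl
    refine ⟨K ∘ₗ e.symm.toLinearMap, ?_, ?_, ?_, ?_⟩
    · intro x y hxy
      exact e.symm.injective (congrArg (fun f : (A.pow 0).Coh 0 => f 0) hxy)
    · intro g _ u
      exact ⟨u, rfl⟩
    · intro g u
      rw [h3]
      rfl
    · intro σ
      refine ⟨e 1, K 1, ?_, ?_, AlternatingMap.constOfIsEmpty ℂ _ _ 1, fun x => rfl⟩
      · intro l _
        simp [hK]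
      · intro h0
        exact one_ne_zero (congrArg (fun f : (A.pow 0).Coh 0 => f 0) h0)

end AbelianVariety

/-! ### Commutative semisimple algebras of maximal dimension -/

/-- A faithful finite dimensional module over a commutative semisimple algebra contains a vector
with trivial annihilator. If `ann v = (e)` with `e` idempotent and `e w ≠ 0`, then
`ann (v + e w)` is strictly smaller than `ann v`. -/
theorem exists_forall_smul_eq_zero {S V : Type*} [CommRing S] [IsSemisimpleRing S]
    [AddCommGroup V] [Module S V] (h : ∀ s : S, (∀ v : V, s • v = 0) → s = 0) :
    ∃ v : V, ∀ s : S, s • v = 0 → s = 0 := by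
  -- `v` is chosen with minimal annihilator.
  obtain ⟨I, ⟨v, rfl⟩, hmin⟩ := (wellFounded_lt (α := Ideal S)).has_min
    (Set.range fun v : V => LinearMap.ker (LinearMap.toSpanSingleton S V v)) ⟨_, 0, rfl⟩
  refine ⟨v, fun s hs => ?_⟩
  obtain ⟨e, he, hv⟩ := IsSemisimpleRing.ideal_eq_span_idempotent
    (LinearMap.ker (LinearMap.toSpanSingleton S V v))
  have hmem : ∀ t : S, t • v = 0 ↔ ∃ a, t = a * e := fun t => by
    have h1 : t • v = 0 ↔ t ∈ LinearMap.ker (LinearMap.toSpanSingleton S V v) := by simp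
    rw [h1, hv, Ideal.mem_span_singleton']
    exact ⟨fun ⟨a, ha⟩ => ⟨a, ha.symm⟩, fun ⟨a, ha⟩ => ⟨a, ha.symm⟩⟩
  have hev : e • v = 0 := (hmem e).2 ⟨1, by simp⟩
  have hee : e * e = e := he
  by_cases he0 : e = 0
  · obtain ⟨a, ha⟩ := (hmem s).1 hs
    rw [ha, he0, mul_zero]
  · exfalso
    obtain ⟨w, hw⟩ : ∃ w : V, e • w ≠ 0 := by
      by_contra! h0
      exact he0 (h e h0)
    refine hmin _ ⟨v + e • w, rfl⟩ (lt_of_le_of_ne ?_ ?_)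
    · intro t ht
      have h1 : t • v + t • e • w = 0 := by simpa using ht
      have h2 : t • e • w = 0 := by
        have h3 := congrArg (e • ·) h1
        simp only [smul_add, smul_zero] at h3
        rw [smul_comm e t v, hev, smul_zero, zero_add, smul_comm e t, smul_smul e e, hee] at h3
        exact h3
      rw [h2, add_zero] at h1
      simpa using h1
    · intro heq
      have h1 : e ∈ LinearMap.ker (LinearMap.toSpanSingleton S V (v + e • w)) := by
        have heq' : LinearMap.ker (LinearMap.toSpanSingleton S V (v + e • w)) =
          LinearMap.ker (LinearMap.toSpanSingleton S V v) := heq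
        rw [heq']; simpa using hev
      have h2 : e • v + e • e • w = 0 := by simpa using h1
      rw [hev, zero_add, smul_smul, hee] at h2
      exact hw h2

/-- Denominators can be cleared in `ℚ ⊗ N`. -/
theorem exists_zsmul_eq_one_tmul {N : Type*} [AddCommGroup N] (x : ℚ ⊗[ℤ] N) :
    ∃ (n : ℤ) (y : N), n ≠ 0 ∧ n • x = 1 ⊗ₜ y := by
  induction x with
  | zero => exact ⟨1, 0, one_ne_zero, by simp⟩
  | tmul q y =>
    refine ⟨q.den, q.num • y, by exact_mod_cast q.den_ne_zero, ?_⟩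
    rw [TensorProduct.smul_tmul', ← TensorProduct.smul_tmul]
    congr 1
    simp [Rat.den_mul_eq_num]
  | add a b ha hb =>
    obtain ⟨n, y, hn, hy⟩ := ha
    obtain ⟨m, z, hm, hz⟩ := hb
    refine ⟨n * m, m • y + n • z, mul_ne_zero hn hm, ?_⟩
    rw [smul_add, TensorProduct.tmul_add, TensorProduct.tmul_smul, TensorProduct.tmul_smul, ← hy,
      ← hz, smul_smul, smul_smul, mul_comm n m]

namespace AbelianVariety

variable {A B : AbelianVariety.{u}}

/-! ### The action of `D(A)` on homology and its commutant -/

/-- The action of an endomorphism on the lattice `H₁(A, ℤ)`. -/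
def latticeEnd (A : AbelianVariety.{u}) : A.endRing →ₐ[ℤ] Module.End ℤ A.lattice :=
  RingHom.toIntAlgHom
    { toFun := fun f => ((f : Module.End ℂ A.Lie).restrictScalars ℤ).restrict f.2
      map_one' := rfl
      map_mul' := fun _ _ => rfl
      map_zero' := rfl
      map_add' := fun _ _ => rfl }

/-- The action of `D(A)` on `H₁(A, ℚ)`. -/
def rationalEnd (A : AbelianVariety.{u}) :
    ℚ ⊗[ℤ] A.endRing →ₐ[ℚ] Module.End ℚ (ℚ ⊗[ℤ] A.lattice) :=
  Algebra.TensorProduct.lift (Algebra.ofId ℚ _)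
    ((Module.End.baseChangeHom ℤ ℚ A.lattice).comp A.latticeEnd)
    (fun _ _ => Algebra.commutes _ _)

theorem rationalEnd_tmul (q : ℚ) (f : A.endRing) (r : ℚ) (x : A.lattice) :
    A.rationalEnd (q ⊗ₜ f) (r ⊗ₜ x) = (q * r) ⊗ₜ (⟨f.1 x, f.2 _ x.2⟩ : A.lattice) := by
  change q • (r ⊗ₜ[ℤ] (⟨f.1 x, f.2 _ x.2⟩ : A.lattice)) = _
  rw [TensorProduct.smul_tmul', smul_eq_mul]

/-- `H₁map` on the ring of endomorphisms. -/
def H₁end (A : AbelianVariety.{u}) : A.endRing →ₐ[ℤ] Module.End ℂ A.H₁ :=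
  RingHom.toIntAlgHom
    { toFun := fun f => H₁map f.1
      map_one' := H₁map_id
      map_mul' := fun _ _ => H₁map_comp _ _
      map_zero' := H₁map_zero
      map_add' := fun _ _ => H₁map_add _ _ }

/-- The action of `D(A)` on `H₁(A, ℂ)`. -/
def complexEnd (A : AbelianVariety.{u}) : ℚ ⊗[ℤ] A.endRing →ₐ[ℤ] Module.End ℂ A.H₁ :=
  Algebra.TensorProduct.lift
    (RingHom.toIntAlgHom ((algebraMap ℂ (Module.End ℂ A.H₁)).comp (algebraMap ℚ ℂ))) A.H₁end
    (fun _ _ => Algebra.commutes _ _)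

theorem complexEnd_tmul (q : ℚ) (f : A.endRing) (x : A.H₁) :
    A.complexEnd (q ⊗ₜ f) x = (q : ℂ) • H₁map f.1 x := by
  simp [complexEnd, Algebra.TensorProduct.lift_tmul, H₁end]

/-- The map `H₁(A, ℚ) → H₁(A, ℂ)`. -/
def rationalToComplex (A : AbelianVariety.{u}) : ℚ ⊗[ℤ] A.lattice →ₗ[ℤ] A.H₁ :=
  TensorProduct.lift (LinearMap.mk₂ ℤ (fun (q : ℚ) (x : A.lattice) => (q : ℂ) ⊗ₜ[ℝ] (x : A.Lie))
    (fun a b x => by simp [TensorProduct.add_tmul])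
    (fun c a x => by
      rw [TensorProduct.smul_tmul']
      simp)
    (fun a x y => by simp [TensorProduct.tmul_add])
    (fun c a x => by
      simp only [Submodule.coe_smul]
      exact map_zsmul (TensorProduct.mk ℝ ℂ A.Lie (a : ℂ)) c (x : A.Lie)))

theorem rationalToComplex_tmul (q : ℚ) (x : A.lattice) :
    A.rationalToComplex (q ⊗ₜ x) = (q : ℂ) ⊗ₜ (x : A.Lie) := rfl

theorem complexEnd_rationalToComplex (s : ℚ ⊗[ℤ] A.endRing) (x : ℚ ⊗[ℤ] A.lattice) :
    A.complexEnd s (A.rationalToComplex x) = A.rationalToComplex (A.rationalEnd s x) := by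
  induction s with
  | zero => simp
  | add s t hs ht => simp [hs, ht]
  | tmul q f =>
    induction x with
    | zero => simp
    | add x y hx hy => simp only [map_add, hx, hy]
    | tmul r x =>
      rw [rationalEnd_tmul, rationalToComplex_tmul, rationalToComplex_tmul, complexEnd_tmul,
        H₁map_tmul, TensorProduct.smul_tmul', smul_eq_mul]
      push_cast
      rfl

theorem one_tmul_injective {x y : A.Lie} (h : (1 : ℂ) ⊗ₜ[ℝ] x = 1 ⊗ₜ y) : x = y :=
  Module.FaithfullyFlat.tensorProduct_mk_injective (A := ℝ) (B := ℂ) A.Lie h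

/-- `D(A)` acts faithfully on `H₁(A, ℚ)`. -/
theorem rationalEnd_injective (A : AbelianVariety.{u}) : Function.Injective A.rationalEnd := by
  rw [injective_iff_map_eq_zero]
  intro s hs
  obtain ⟨n, f, hn, hf⟩ := exists_zsmul_eq_one_tmul s
  have h1 : ∀ x : A.lattice, f.1 x = 0 := by
    intro x
    have h2 : A.rationalEnd (1 ⊗ₜ f) (1 ⊗ₜ x) = 0 := by
      rw [← hf, map_zsmul, hs, smul_zero, LinearMap.zero_apply]
    rw [rationalEnd_tmul] at h2
    have h3 := congrArg A.rationalToComplex h2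
    rw [rationalToComplex_tmul, map_zero, ← TensorProduct.tmul_zero A.Lie (1 : ℂ)] at h3
    exact one_tmul_injective (by simpa using h3)
  have h2 : f = 0 := by
    refine Subtype.ext (LinearMap.ext fun x => ?_)
    have h3 : (f.1.restrictScalars ℝ : A.Lie →ₗ[ℝ] A.Lie) = 0 :=
      LinearMap.ext_on (IsZLattice.span_top (K := ℝ) (L := A.lattice)) fun x hx => h1 ⟨x, hx⟩
    exact LinearMap.congr_fun h3 x
  rw [h2, TensorProduct.tmul_zero] at hf
  have hn' : (n : ℚ) ≠ 0 := by exact_mod_cast hn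
  rw [← inv_smul_smul₀ hn' s, Int.cast_smul_eq_zsmul, hf, smul_zero]

theorem finrank_rational (A : AbelianVariety.{u}) :
    Module.finrank ℚ (ℚ ⊗[ℤ] A.lattice) = 2 * A.dim := by
  rw [Module.finrank_baseChange, ZLattice.rank ℝ A.lattice, finrank_real_of_complex]
  rfl

theorem span_range_rationalToComplex (A : AbelianVariety.{u}) :
    Submodule.span ℂ (Set.range A.rationalToComplex) = ⊤ := by
  rw [eq_top_iff, ← span_lattice A, Submodule.span_le]
  rintro _ ⟨x, hx, rfl⟩
  exact Submodule.subset_span ⟨1 ⊗ₜ ⟨x, hx⟩, by simp [rationalToComplex_tmul]⟩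

/-- The commutant in `GL(H₁(A, ℂ))` of a subset of `D(A)`. -/
def commutant (A : AbelianVariety.{u}) (S : Set (ℚ ⊗[ℤ] A.endRing)) : Subgroup A.GLH₁ where
  carrier := {g | ∀ s ∈ S, ∀ x, g (A.complexEnd s x) = A.complexEnd s (g x)}
  mul_mem' {g h} hg hh s hs x := by
    rw [LinearEquiv.mul_apply, LinearEquiv.mul_apply, hh s hs, hg s hs]
  one_mem' _ _ _ := rfl
  inv_mem' {g} hg s hs x := g.injective (by
    rw [apply_inv_self, hg s hs, apply_inv_self])

theorem coeff_mem_rationalFunctions {v : A.Lie} (hv : v ∈ A.lattice) {l : A.H₁ →ₗ[ℂ] ℂ}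
    (hl : A.IsRational l) : (fun g : A.GLH₁ => l (g (1 ⊗ₜ v))) ∈ A.rationalFunctions :=
  Algebra.subset_adjoin ⟨v, hv, l, hl, Or.inl rfl⟩

theorem inv_coeff_mem_rationalFunctions {v : A.Lie} (hv : v ∈ A.lattice) {l : A.H₁ →ₗ[ℂ] ℂ}
    (hl : A.IsRational l) : (fun g : A.GLH₁ => l (g⁻¹ (1 ⊗ₜ v))) ∈ A.rationalFunctions :=
  Algebra.subset_adjoin ⟨v, hv, l, hl, Or.inr rfl⟩

theorem coeff_complexEnd_mem (s : ℚ ⊗[ℤ] A.endRing) {v : A.Lie} (hv : v ∈ A.lattice)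
    {l : A.H₁ →ₗ[ℂ] ℂ} (hl : A.IsRational l) :
    (fun g : A.GLH₁ => l (g (A.complexEnd s (1 ⊗ₜ v)))) ∈ A.rationalFunctions := by
  induction s with
  | zero =>
    convert A.rationalFunctions.zero_mem using 1
    ext g
    simp
  | add s t hs ht =>
    have h := A.rationalFunctions.add_mem hs ht
    convert h using 1
    ext g
    simp
  | tmul q f =>
    have h := A.rationalFunctions.smul_mem (coeff_mem_rationalFunctions (f.2 v hv) hl) q
    convert h using 1
    ext g
    simp [complexEnd_tmul, Rat.smul_def]

theorem IsRational.comp_complexEnd (s : ℚ ⊗[ℤ] A.endRing) {l : A.H₁ →ₗ[ℂ] ℂ}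
    (hl : A.IsRational l) : A.IsRational (l ∘ₗ A.complexEnd s) := by
  intro w hw
  induction s with
  | zero => exact ⟨0, by simp⟩
  | add s t hs ht =>
    obtain ⟨a, ha⟩ := hs
    obtain ⟨b, hb⟩ := ht
    refine ⟨a + b, ?_⟩
    simp only [LinearMap.comp_apply] at ha hb ⊢
    simp [ha, hb]
  | tmul q f =>
    obtain ⟨a, ha⟩ := hl (f.1 w) (f.2 w hw)
    exact ⟨q * a, by simp [complexEnd_tmul, ha]⟩

/-- The commutant is algebraic over `ℚ`: `g s = s g` is tested on lattice vectors, by rational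
linear forms. -/
theorem isRationalAlgebraic_commutant (S : Set (ℚ ⊗[ℤ] A.endRing)) :
    A.IsRationalAlgebraic (A.commutant S) := by
  refine ⟨{F | ∃ s ∈ S, ∃ v ∈ A.lattice, ∃ l, A.IsRational l ∧
    F = (fun g => l (g (A.complexEnd s (1 ⊗ₜ v)))) -
      (fun g : A.GLH₁ => (l ∘ₗ A.complexEnd s) (g (1 ⊗ₜ v)))}, ?_, fun g => ⟨?_, ?_⟩⟩
  · rintro _ ⟨s, hs, v, hv, l, hl, rfl⟩
    exact A.rationalFunctions.sub_mem (coeff_complexEnd_mem s hv hl)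
      (coeff_mem_rationalFunctions hv (hl.comp_complexEnd s))
  · rintro hg _ ⟨s, hs, v, hv, l, hl, rfl⟩
    simp [hg s hs]
  · intro h s hs x
    have h1 : g.toLinearMap ∘ₗ A.complexEnd s = A.complexEnd s ∘ₗ g.toLinearMap :=
      H₁_hom_ext fun v hv => eq_of_isRational fun l hl =>
        sub_eq_zero.1 (h _ ⟨s, hs, v, hv, l, hl, rfl⟩)
    exact LinearMap.congr_fun h1 x

theorem hodgeHom_tmul (z : Circle) (c : ℂ) (x : A.Lie) :
    A.hodgeHom z (c ⊗ₜ x) = c ⊗ₜ ((z : ℂ) • x) := rfl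

/-- The complex structure commutes with the maps induced by `ℂ`-linear maps. -/
theorem hodgeHom_H₁map (z : Circle) (f : A.Lie →ₗ[ℂ] B.Lie) (x : A.H₁) :
    B.hodgeHom z (H₁map f x) = H₁map f (A.hodgeHom z x) := by
  induction x using TensorProduct.induction_on with
  | zero => simp
  | add x y hx hy => simp [hx, hy]
  | tmul c x => rw [H₁map_tmul, hodgeHom_tmul, hodgeHom_tmul, H₁map_tmul, map_smul]

theorem hodgeHom_mem_commutant (S : Set (ℚ ⊗[ℤ] A.endRing)) (z : Circle) :
    A.hodgeHom z ∈ A.commutant S := by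
  intro s hs x
  clear hs
  induction s with
  | zero => simp
  | add s t hs ht => simp [hs, ht]
  | tmul q f => rw [complexEnd_tmul, complexEnd_tmul, map_smul, hodgeHom_H₁map]

theorem hodgeGroup_le_commutant (S : Set (ℚ ⊗[ℤ] A.endRing)) : A.hodgeGroup ≤ A.commutant S :=
  sInf_le ⟨isRationalAlgebraic_commutant S, hodgeHom_mem_commutant S⟩

/-- A commutative semisimple subalgebra `S` of `D(A)` of dimension `2 dim A` has a cyclic vector in
`H₁(A, ℚ)`. -/
theorem exists_cyclic_vector (S : Subalgebra ℚ (ℚ ⊗[ℤ] A.endRing))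
    (hcomm : ∀ x ∈ S, ∀ y ∈ S, x * y = y * x) (hss : IsSemisimpleRing S)
    (hdim : Module.finrank ℚ S = 2 * A.dim) :
    ∃ v : ℚ ⊗[ℤ] A.lattice, ∀ w, ∃ s ∈ S, A.rationalEnd s v = w := by
  let _ : CommRing S := { (inferInstance : Ring S) with
    mul_comm := fun x y => Subtype.ext (hcomm x x.2 y y.2) }
  have hfd : FiniteDimensional ℚ (ℚ ⊗[ℤ] A.lattice) := inferInstance
  let φ : S →ₐ[ℚ] Module.End ℚ (ℚ ⊗[ℤ] A.lattice) := A.rationalEnd.comp S.val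
  have hφ : Function.Injective φ := (rationalEnd_injective A).comp Subtype.val_injective
  have : FiniteDimensional ℚ S := FiniteDimensional.of_injective φ.toLinearMap hφ
  let _ : Module S (ℚ ⊗[ℤ] A.lattice) := Module.compHom _ φ.toRingHom
  obtain ⟨v, hv⟩ := exists_forall_smul_eq_zero (S := S) (V := ℚ ⊗[ℤ] A.lattice) fun s hs =>
    hφ ((LinearMap.ext fun w => hs w : φ s = 0).trans (map_zero φ).symm)
  -- Evaluation at `v` is injective between spaces of the same dimension.
  let ev : S →ₗ[ℚ] ℚ ⊗[ℤ] A.lattice := (LinearMap.applyₗ v) ∘ₗ φ.toLinearMap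
  have hev : Function.Injective ev := by
    rw [injective_iff_map_eq_zero]
    exact hv
  have hsurj := (LinearMap.injective_iff_surjective_of_finrank_eq_finrank
    (hdim.trans (finrank_rational A).symm)).1 hev
  refine ⟨v, fun w => ?_⟩
  obtain ⟨s, hs⟩ := hsurj w
  exact ⟨s, s.2, hs⟩

/-- The commutant of a commutative algebra with a cyclic vector is commutative: its members act on
the cyclic vector as members of the algebra. -/
theorem commutant_commute (S : Subalgebra ℚ (ℚ ⊗[ℤ] A.endRing))
    (hcomm : ∀ x ∈ S, ∀ y ∈ S, x * y = y * x) {v : ℚ ⊗[ℤ] A.lattice}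
    (hv : ∀ w, ∃ s ∈ S, A.rationalEnd s v = w) {g h : A.GLH₁} (hg : g ∈ A.commutant S)
    (hh : h ∈ A.commutant S) : g * h = h * g := by
  set v₀ := A.rationalToComplex v
  let C : Submodule ℂ (Module.End ℂ A.H₁) := Submodule.span ℂ (A.complexEnd '' S)
  have hC : ∀ x : A.H₁, ∃ c ∈ C, c v₀ = x := by
    intro x
    have hx : x ∈ Submodule.span ℂ (Set.range A.rationalToComplex) := by
      rw [span_range_rationalToComplex]; trivial
    induction hx using Submodule.span_induction with
    | mem x hx =>
      obtain ⟨w, rfl⟩ := hx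
      obtain ⟨s, hs, rfl⟩ := hv w
      exact ⟨A.complexEnd s, Submodule.subset_span ⟨s, hs, rfl⟩,
        complexEnd_rationalToComplex s v⟩
    | zero => exact ⟨0, C.zero_mem, rfl⟩
    | add x y _ _ hx hy =>
      obtain ⟨c, hc, rfl⟩ := hx
      obtain ⟨c', hc', rfl⟩ := hy
      exact ⟨c + c', C.add_mem hc hc', rfl⟩
    | smul a x _ hx =>
      obtain ⟨c, hc, rfl⟩ := hx
      exact ⟨a • c, C.smul_mem a hc, rfl⟩
  have hcommC : ∀ k ∈ A.commutant S, ∀ c ∈ C, ∀ x, k (c x) = c (k x) := by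
    intro k hk c hc
    induction hc using Submodule.span_induction with
    | mem c hc =>
      obtain ⟨s, hs, rfl⟩ := hc
      exact hk s hs
    | zero => simp
    | add c c' _ _ hc hc' => intro x; simp [hc, hc']
    | smul a c _ hc => intro x; simp [hc]
  have hCC : ∀ c ∈ C, ∀ c' ∈ C, c * c' = c' * c := by
    intro c hc c' hc'
    induction hc, hc' using Submodule.span_induction₂ with
    | mem_mem c c' hc hc' =>
      obtain ⟨s, hs, rfl⟩ := hc
      obtain ⟨t, ht, rfl⟩ := hc'
      rw [← map_mul, ← map_mul, hcomm s hs t ht]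
    | zero_left => simp
    | zero_right => simp
    | add_left c d e _ _ _ h1 h2 => rw [add_mul, mul_add, h1, h2]
    | add_right c d e _ _ _ h1 h2 => rw [add_mul, mul_add, h1, h2]
    | smul_left a c d _ _ h1 => rw [smul_mul_assoc, mul_smul_comm, h1]
    | smul_right a c d _ _ h1 => rw [smul_mul_assoc, mul_smul_comm, h1]
  obtain ⟨c, hc, hcg⟩ := hC (g v₀)
  obtain ⟨c', hc', hch⟩ := hC (h v₀)
  have hv₀ : g (h v₀) = h (g v₀) := by
    rw [← hch, ← hcg, hcommC g hg c' hc', hcommC h hh c hc, ← hch, ← hcg]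
    exact LinearMap.congr_fun (hCC c' hc' c hc) v₀
  refine LinearEquiv.ext fun x => ?_
  obtain ⟨d, hd, rfl⟩ := hC x
  change g (h (d v₀)) = h (g (d v₀))
  rw [hcommC h hh d hd, hcommC g hg d hd, hcommC g hg d hd, hcommC h hh d hd, hv₀]

/-- For an abelian variety of CM-type the Hodge group is commutative, so its derived group is
trivial. -/
theorem IsCMType.derivedHodgeGroup_eq_bot (h : A.IsCMType) : A.derivedHodgeGroup = ⊥ := by
  obtain ⟨S, hcomm, hss, hdim⟩ := h
  obtain ⟨v, hv⟩ := exists_cyclic_vector S hcomm hss hdim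
  rw [derivedHodgeGroup, Subgroup.commutator_eq_bot_iff_le_centralizer]
  intro g hg
  rw [Subgroup.mem_centralizer_iff]
  intro k hk
  exact commutant_commute S hcomm hv (hodgeGroup_le_commutant _ hk) (hodgeGroup_le_commutant _ hg)

theorem IsCMType.isWeaklySelfDominated (h : A.IsCMType) : A.IsWeaklySelfDominated := by
  intro U _ _ _ ρ _ _ h3
  obtain ⟨g, v, hgv⟩ := h3
  have hg : g = 1 := Subtype.ext (Subgroup.mem_bot.1 (h.derivedHodgeGroup_eq_bot ▸ g.2))
  rw [hg, map_one] at hgv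
  exact (hgv rfl).elim

/-! ### Direct factors -/

/-- The block of `g` on a direct factor `A` of `B`, provided that `g` commutes with the
corresponding idempotent. -/
theorem exists_block {π : B.Lie →ₗ[ℂ] A.Lie} {s : A.Lie →ₗ[ℂ] B.Lie} (h : π ∘ₗ s = LinearMap.id)
    {g : B.GLH₁} (hg : ∀ x, g (H₁map (s ∘ₗ π) x) = H₁map (s ∘ₗ π) (g x)) :
    ∃ a : A.GLH₁, ∀ x, H₁map π (g x) = a (H₁map π x) := by
  have hπs : ∀ x, H₁map π (H₁map s x) = x := fun x => by rw [H₁map_apply_apply, h]; simp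
  have hg1 : ∀ x, g (H₁map s (H₁map π x)) = H₁map s (H₁map π (g x)) := fun x => by
    rw [H₁map_apply_apply, H₁map_apply_apply, hg]
  have hg2 : ∀ x, g⁻¹ (H₁map s (H₁map π x)) = H₁map s (H₁map π (g⁻¹ x)) := fun x => by
    rw [← inv_apply_self g (H₁map s (H₁map π (g⁻¹ x))), hg1 (g⁻¹ x), apply_inv_self]
  refine ⟨LinearEquiv.ofLinearMap (H₁map π ∘ₗ g.toLinearMap ∘ₗ H₁map s)
    (H₁map π ∘ₗ (g⁻¹ : B.GLH₁).toLinearMap ∘ₗ H₁map s) ?_ ?_, fun x => ?_⟩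
  · refine LinearMap.ext fun x => ?_
    change H₁map π (g (H₁map s (H₁map π (g⁻¹ (H₁map s x))))) = x
    rw [hg1, apply_inv_self, hπs, hπs]
  · refine LinearMap.ext fun x => ?_
    change H₁map π (g⁻¹ (H₁map s (H₁map π (g (H₁map s x))))) = x
    rw [hg2, inv_apply_self, hπs, hπs]
  · change H₁map π (g x) = H₁map π (g (H₁map s (H₁map π x)))
    rw [hg1, hπs]

theorem baseChange_comp_H₁map (β : LinearMap.BilinForm ℝ A.Lie) (π : B.Lie →ₗ[ℂ] A.Lie)
    (x y : B.H₁) :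
    LinearMap.BilinForm.baseChange ℂ
      (β.compl₁₂ (π.restrictScalars ℝ) (π.restrictScalars ℝ)) x y =
      β.baseChange ℂ (H₁map π x) (H₁map π y) := by
  induction x using TensorProduct.induction_on with
  | zero => simp
  | add x x' hx hx' => simp [hx, hx']
  | tmul c x =>
    induction y using TensorProduct.induction_on with
    | zero => simp
    | add y y' hy hy' => rw [map_add, map_add, map_add, hy, hy']
    | tmul c' y => simp [LinearMap.BilinForm.baseChange_tmul]

theorem IsRiemannForm.nonneg {β : LinearMap.BilinForm ℝ A.Lie} (hβ : IsRiemannForm A.lattice β)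
    (x : A.Lie) : 0 ≤ β (Complex.I • x) x := by
  by_cases h : x = 0
  · simp [h]
  · exact (hβ.pos x h).le

/-- A Riemann form of a direct factor `A` of `B` extends to `B`: add the restriction of a Riemann
form of `B` to the complement. -/
theorem exists_isRiemannForm_extend {π : B.Lie →ₗ[ℂ] A.Lie} {s : A.Lie →ₗ[ℂ] B.Lie}
    (h : π ∘ₗ s = LinearMap.id) (hπ : ∀ x ∈ B.lattice, π x ∈ A.lattice)
    (hs : ∀ x ∈ A.lattice, s x ∈ B.lattice) {β : LinearMap.BilinForm ℝ A.Lie}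
    (hβ : IsRiemannForm A.lattice β) :
    ∃ β' : LinearMap.BilinForm ℝ B.Lie, IsRiemannForm B.lattice β' ∧
      ∀ x y : A.H₁, β'.baseChange ℂ (H₁map s x) (H₁map s y) = β.baseChange ℂ x y := by
  obtain ⟨γ, hγ⟩ := B.polarizable
  have hπs : ∀ x, π (s x) = x := LinearMap.congr_fun h
  -- `κ` is the projection onto the complement of `A`; it kills the image of `s`.
  let κ : B.Lie →ₗ[ℂ] B.Lie := LinearMap.id - s ∘ₗ π
  have hκs : κ ∘ₗ s = 0 := LinearMap.ext fun x => by simp [κ, hπs]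
  have hκ : ∀ x ∈ B.lattice, κ x ∈ B.lattice := fun x hx =>
    B.lattice.sub_mem hx (hs _ (hπ x hx))
  refine ⟨β.compl₁₂ (π.restrictScalars ℝ) (π.restrictScalars ℝ) +
    γ.compl₁₂ (κ.restrictScalars ℝ) (κ.restrictScalars ℝ), ⟨?_, ?_, ?_, ?_⟩, ?_⟩
  · intro x
    simp [hβ.alt, hγ.alt]
  · intro x hx y hy
    obtain ⟨k, hk⟩ := hβ.integral _ (hπ x hx) _ (hπ y hy)
    obtain ⟨l, hl⟩ := hγ.integral _ (hκ x hx) _ (hκ y hy)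
    exact ⟨k + l, by simp [hk, hl]⟩
  · intro x y
    simp [hβ.hermitian, hγ.hermitian]
  · intro x hx
    have h1 := IsRiemannForm.nonneg hβ (π x)
    have h2 := IsRiemannForm.nonneg hγ (κ x)
    by_cases h0 : π x = 0
    · have h3 : κ x ≠ 0 := by simpa [κ, h0] using hx
      simpa using add_pos_of_nonneg_of_pos h1 (hγ.pos _ h3)
    · simpa using add_pos_of_pos_of_nonneg (hβ.pos _ h0) h2
  · intro x y
    have hadd : ∀ (b c : LinearMap.BilinForm ℝ B.Lie),
        (b + c).baseChange ℂ = b.baseChange ℂ + c.baseChange ℂ := by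
      intro b c
      refine LinearMap.ext fun x => LinearMap.ext fun y => ?_
      induction x using TensorProduct.induction_on with
      | zero => simp
      | add x x' hx hx' => simp only [map_add, LinearMap.add_apply] at hx hx' ⊢; rw [hx, hx']
      | tmul c x =>
        induction y using TensorProduct.induction_on with
        | zero => simp
        | add y y' hy hy' => rw [map_add, map_add, hy, hy']
        | tmul c' y => simp [LinearMap.BilinForm.baseChange_tmul, add_smul]
    rw [hadd, LinearMap.add_apply, LinearMap.add_apply, baseChange_comp_H₁map,
      baseChange_comp_H₁map, H₁map_apply_apply, H₁map_apply_apply, H₁map_apply_apply,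
      H₁map_apply_apply, h, hκs]
    simp

/-- The Lefschetz group of `B` acts on a direct factor `A` through the Lefschetz group of `A`. -/
theorem exists_mem_lefschetzGroup {π : B.Lie →ₗ[ℂ] A.Lie} {s : A.Lie →ₗ[ℂ] B.Lie}
    (h : π ∘ₗ s = LinearMap.id) (hπ : ∀ x ∈ B.lattice, π x ∈ A.lattice)
    (hs : ∀ x ∈ A.lattice, s x ∈ B.lattice) {g : B.GLH₁} (hg : g ∈ B.lefschetzGroup) :
    ∃ a ∈ A.lefschetzGroup, ∀ x, H₁map π (g x) = a (H₁map π x) := by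
  have hπs : ∀ x, H₁map π (H₁map s x) = x := fun x => by rw [H₁map_apply_apply, h]; simp
  have hidem := hg.1 (s ∘ₗ π) fun x hx => hs _ (hπ x hx)
  obtain ⟨a, ha⟩ := exists_block h hidem
  have hsa : ∀ x, g (H₁map s x) = H₁map s (a x) := by
    intro x
    have h1 := hidem (H₁map s x)
    rw [← H₁map_apply_apply, hπs, ← H₁map_apply_apply, ha, hπs] at h1
    exact h1
  refine ⟨a, ⟨fun f hf x => ?_, fun β hβ x y => ?_⟩, ha⟩
  · have h1 := congrArg (H₁map π)
      (hg.1 (s ∘ₗ f ∘ₗ π) (fun x hx => hs _ (hf _ (hπ x hx))) (H₁map s x))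
    simpa only [ha, H₁map_comp, LinearMap.comp_apply, hπs] using h1
  · obtain ⟨β', hβ', hr⟩ := exists_isRiemannForm_extend h hπ hs hβ
    rw [← hr, ← hsa, ← hsa, hg.2 β' hβ', hr]

/-! ### Regular functions -/

theorem coeff_mem_regularFunctions (v : A.H₁) (l : A.H₁ →ₗ[ℂ] ℂ) :
    (fun g : A.GLH₁ => l (g v)) ∈ A.regularFunctions :=
  Algebra.subset_adjoin ⟨v, l, Or.inl rfl⟩

theorem inv_coeff_mem_regularFunctions (v : A.H₁) (l : A.H₁ →ₗ[ℂ] ℂ) :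
    (fun g : A.GLH₁ => l (g⁻¹ v)) ∈ A.regularFunctions :=
  Algebra.subset_adjoin ⟨v, l, Or.inr rfl⟩

/-- A map `GL(H₁(B)) → GL(H₁(A))` is regular if this holds for the matrix coefficients. -/
theorem comp_mem_regularFunctions {Φ : B.GLH₁ → A.GLH₁}
    (h₁ : ∀ v (l : A.H₁ →ₗ[ℂ] ℂ), (fun g => l (Φ g v)) ∈ B.regularFunctions)
    (h₂ : ∀ v (l : A.H₁ →ₗ[ℂ] ℂ), (fun g => l ((Φ g)⁻¹ v)) ∈ B.regularFunctions) {F : A.GLH₁ → ℂ}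
    (hF : F ∈ A.regularFunctions) : (fun g => F (Φ g)) ∈ B.regularFunctions := by
  induction hF using Algebra.adjoin_induction with
  | mem F hF =>
    obtain ⟨v, l, rfl | rfl⟩ := hF
    · exact h₁ v l
    · exact h₂ v l
  | algebraMap r => exact B.regularFunctions.algebraMap_mem r
  | add F F' _ _ h h' => exact B.regularFunctions.add_mem h h'
  | mul F F' _ _ h h' => exact B.regularFunctions.mul_mem h h'

theorem comp_mem_rationalFunctions {Φ : B.GLH₁ → A.GLH₁}
    (h₁ : ∀ v ∈ A.lattice, ∀ l, A.IsRational l →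
      (fun g => l (Φ g (1 ⊗ₜ v))) ∈ B.rationalFunctions)
    (h₂ : ∀ v ∈ A.lattice, ∀ l, A.IsRational l →
      (fun g => l ((Φ g)⁻¹ (1 ⊗ₜ v))) ∈ B.rationalFunctions) {F : A.GLH₁ → ℂ}
    (hF : F ∈ A.rationalFunctions) : (fun g => F (Φ g)) ∈ B.rationalFunctions := by
  induction hF using Algebra.adjoin_induction with
  | mem F hF =>
    obtain ⟨v, hv, l, hl, rfl | rfl⟩ := hF
    · exact h₁ v hv l hl
    · exact h₂ v hv l hl
  | algebraMap r => exact B.rationalFunctions.algebraMap_mem r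
  | add F F' _ _ h h' => exact B.rationalFunctions.add_mem h h'
  | mul F F' _ _ h h' => exact B.rationalFunctions.mul_mem h h'

/-! ### The Hodge group of a power -/

/-- The diagonal action `GL(H₁(A)) → GL(H₁(A ^ n))`. -/
def powHom (A : AbelianVariety.{u}) (n : ℕ) : A.GLH₁ →* (A.pow n).GLH₁ where
  toFun g := LinearEquiv.ofLinearMap (A.diag n g.toLinearMap) (A.diag n (g⁻¹ : A.GLH₁).toLinearMap)
    (LinearMap.ext fun x => pow_H₁_ext fun i => by
      rw [LinearMap.comp_apply, H₁map_proj_diag, H₁map_proj_diag]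
      exact apply_inv_self g _)
    (LinearMap.ext fun x => pow_H₁_ext fun i => by
      rw [LinearMap.comp_apply, H₁map_proj_diag, H₁map_proj_diag]
      exact inv_apply_self g _)
  map_one' := LinearEquiv.ext fun x => pow_H₁_ext fun i => H₁map_proj_diag _ i x
  map_mul' g h := LinearEquiv.ext fun x => pow_H₁_ext fun i => by
    change H₁map (A.proj n i) (A.diag n (g * h : A.GLH₁).toLinearMap x) =
      H₁map (A.proj n i) (A.diag n g.toLinearMap (A.diag n h.toLinearMap x))
    rw [H₁map_proj_diag, H₁map_proj_diag, H₁map_proj_diag]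
    rfl

theorem powHom_apply {n : ℕ} (g : A.GLH₁) (x : (A.pow n).H₁) :
    A.powHom n g x = ∑ i, H₁map (A.single n i) (g (H₁map (A.proj n i) x)) := by
  change A.diag n g.toLinearMap x = _
  simp [diag, LinearMap.sum_apply]

theorem H₁map_proj_powHom {n : ℕ} (g : A.GLH₁) (i : Fin n) (x : (A.pow n).H₁) :
    H₁map (A.proj n i) (A.powHom n g x) = g (H₁map (A.proj n i) x) :=
  H₁map_proj_diag _ i x

theorem powHom_comp_mem_regularFunctions {n : ℕ} {F : (A.pow n).GLH₁ → ℂ}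
    (hF : F ∈ (A.pow n).regularFunctions) :
    (fun g => F (A.powHom n g)) ∈ A.regularFunctions := by
  refine comp_mem_regularFunctions (fun v l => ?_) (fun v l => ?_) hF
  · have h := A.regularFunctions.sum_mem (t := Finset.univ) fun i _ =>
      coeff_mem_regularFunctions (H₁map (A.proj n i) v) (l ∘ₗ H₁map (A.single n i))
    convert h using 1
    ext g
    simp [powHom_apply]
  · have h := A.regularFunctions.sum_mem (t := Finset.univ) fun i _ =>
      inv_coeff_mem_regularFunctions (H₁map (A.proj n i) v) (l ∘ₗ H₁map (A.single n i))
    convert h using 1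
    ext g
    simp [← map_inv, powHom_apply]

theorem proj_mem_lattice {n : ℕ} (i : Fin n) :
    ∀ x ∈ (A.pow n).lattice, A.proj n i x ∈ A.lattice := fun _ hx => hx i trivial

theorem single_mem_lattice {n : ℕ} (i : Fin n) :
    ∀ x ∈ A.lattice, A.single n i x ∈ (A.pow n).lattice := by
  intro x hx j _
  change (Pi.single i x : Fin n → A.Lie) j ∈ A.lattice
  by_cases h : j = i
  · subst h; simpa using hx
  · simp [Pi.single_eq_of_ne h]

theorem powHom_comp_mem_rationalFunctions {n : ℕ} {F : (A.pow n).GLH₁ → ℂ}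
    (hF : F ∈ (A.pow n).rationalFunctions) :
    (fun g => F (A.powHom n g)) ∈ A.rationalFunctions := by
  refine comp_mem_rationalFunctions (fun v hv l hl => ?_) (fun v hv l hl => ?_) hF
  · have h := A.rationalFunctions.sum_mem (t := Finset.univ) fun i _ =>
      coeff_mem_rationalFunctions (proj_mem_lattice i v hv)
        (hl.comp_H₁map (single_mem_lattice i))
    convert h using 1
    ext g
    simp [powHom_apply]
  · have h := A.rationalFunctions.sum_mem (t := Finset.univ) fun i _ =>
      inv_coeff_mem_rationalFunctions (proj_mem_lattice i v hv)
        (hl.comp_H₁map (single_mem_lattice i))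
    convert h using 1
    ext g
    simp [← map_inv, powHom_apply]

/-- Rational functions on `GL(H₁(A))` extend to `GL(H₁(A ^ n))`, through a diagonal block. -/
theorem exists_rationalFunction_extend {n : ℕ} (i : Fin n) {f : A.GLH₁ → ℂ}
    (hf : f ∈ A.rationalFunctions) :
    ∃ F ∈ (A.pow n).rationalFunctions, ∀ a, F (A.powHom n a) = f a := by
  have hblock : ∀ (a : A.GLH₁) (v : A.Lie), H₁map (A.proj n i)
      (A.powHom n a (1 ⊗ₜ A.single n i v)) = a (1 ⊗ₜ v) := by
    intro a v
    rw [H₁map_proj_powHom, ← H₁map_tmul, H₁map_proj_single, if_pos rfl]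
  induction hf using Algebra.adjoin_induction with
  | mem f hf =>
    obtain ⟨v, hv, l, hl, rfl | rfl⟩ := hf
    · exact ⟨_, coeff_mem_rationalFunctions (single_mem_lattice i v hv)
        (IsRational.comp_H₁map hl (proj_mem_lattice i)), fun a => congrArg l (hblock a v)⟩
    · refine ⟨_, inv_coeff_mem_rationalFunctions (single_mem_lattice i v hv)
        (IsRational.comp_H₁map hl (proj_mem_lattice i)), fun a => ?_⟩
      simp only [← map_inv]
      exact congrArg l (hblock _ v)
  | algebraMap r => exact ⟨_, (A.pow n).rationalFunctions.algebraMap_mem r, fun _ => rfl⟩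
  | add f f' _ _ h h' =>
    obtain ⟨F, hF, hFf⟩ := h
    obtain ⟨F', hF', hFf'⟩ := h'
    exact ⟨_, (A.pow n).rationalFunctions.add_mem hF hF', fun a => by simp [hFf, hFf']⟩
  | mul f f' _ _ h h' =>
    obtain ⟨F, hF, hFf⟩ := h
    obtain ⟨F', hF', hFf'⟩ := h'
    exact ⟨_, (A.pow n).rationalFunctions.mul_mem hF hF', fun a => by simp [hFf, hFf']⟩

theorem powHom_comm {n : ℕ} (a : A.GLH₁) (i j : Fin n) (x : (A.pow n).H₁) :
    A.powHom n a (H₁map (A.single n i ∘ₗ A.proj n j) x) =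
      H₁map (A.single n i ∘ₗ A.proj n j) (A.powHom n a x) := by
  refine pow_H₁_ext fun k => ?_
  rw [H₁map_proj_powHom, ← H₁map_apply_apply, ← H₁map_apply_apply, H₁map_proj_single,
    H₁map_proj_single, H₁map_proj_powHom]
  split_ifs <;> simp

/-- An automorphism of `H₁(A ^ n)` which commutes with the matrix units is diagonal. -/
theorem exists_powHom_eq {n : ℕ} (i₀ : Fin n) {g : (A.pow n).GLH₁}
    (hg : ∀ i j x, g (H₁map (A.single n i ∘ₗ A.proj n j) x) =
      H₁map (A.single n i ∘ₗ A.proj n j) (g x)) : ∃ a, A.powHom n a = g := by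
  obtain ⟨a, ha⟩ := exists_block (by rw [proj_comp_single, if_pos rfl]) (hg i₀ i₀)
  refine ⟨a, LinearEquiv.ext fun x => pow_H₁_ext fun i => ?_⟩
  have h := congrArg (H₁map (A.proj n i₀)) (hg i₀ i x)
  rw [ha, ← H₁map_apply_apply, ← H₁map_apply_apply, H₁map_proj_single, H₁map_proj_single,
    if_pos rfl, if_pos rfl] at h
  rw [H₁map_proj_powHom, h]

theorem powHom_injective {n : ℕ} (i₀ : Fin n) : Function.Injective (A.powHom n) := by
  intro a b hab
  refine LinearEquiv.ext fun x => ?_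
  have h := congrArg (fun g : (A.pow n).GLH₁ => H₁map (A.proj n i₀) (g (H₁map (A.single n i₀) x)))
    hab
  simpa only [H₁map_proj_powHom, H₁map_proj_single, if_true] using h

/-- The diagonal image of an algebraic group over `ℚ` is algebraic over `ℚ`. It is cut out by the
equations of commutation with the matrix units, which make an automorphism diagonal, and by
extensions of the equations of the given group. -/
theorem isRationalAlgebraic_map_powHom {n : ℕ} (i₀ : Fin n) {H : Subgroup A.GLH₁}
    (hH : A.IsRationalAlgebraic H) : (A.pow n).IsRationalAlgebraic (H.map (A.powHom n)) := by
  obtain ⟨S, hS, hSH⟩ := hH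
  -- All rational functions which vanish on the image are taken as equations.
  refine ⟨{F | F ∈ (A.pow n).rationalFunctions ∧ ∀ a ∈ H, F (A.powHom n a) = 0},
    fun F hF => hF.1, fun g => ⟨?_, fun hg => ?_⟩⟩
  · rintro ⟨a, ha, rfl⟩ F hF
    exact hF.2 a ha
  · obtain ⟨a, rfl⟩ : ∃ a, A.powHom n a = g := by
      refine exists_powHom_eq i₀ fun i j x => ?_
      have hlat : ∀ x ∈ (A.pow n).lattice,
          (A.single n i ∘ₗ A.proj n j) x ∈ (A.pow n).lattice := fun x hx =>
        single_mem_lattice i _ (proj_mem_lattice j x hx)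
      have h1 : g.toLinearMap ∘ₗ H₁map (A.single n i ∘ₗ A.proj n j) =
          H₁map (A.single n i ∘ₗ A.proj n j) ∘ₗ g.toLinearMap := by
        refine H₁_hom_ext fun v hv => eq_of_isRational fun l hl => sub_eq_zero.1 ?_
        refine hg ((fun g => l (g (1 ⊗ₜ (A.single n i ∘ₗ A.proj n j) v))) -
          fun g => (l ∘ₗ H₁map (A.single n i ∘ₗ A.proj n j)) (g (1 ⊗ₜ v)))
          ⟨Subalgebra.sub_mem _ (coeff_mem_rationalFunctions (hlat v hv) hl)
            (coeff_mem_rationalFunctions hv (hl.comp_H₁map hlat)), fun a _ => ?_⟩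
        rw [Pi.sub_apply, ← H₁map_tmul, powHom_comm, LinearMap.comp_apply, sub_self]
      exact LinearMap.congr_fun h1 x
    refine ⟨a, (hSH a).2 fun f hf => ?_, rfl⟩
    obtain ⟨F, hF, hFf⟩ := exists_rationalFunction_extend i₀ (hS hf)
    rw [← hFf]
    exact hg F ⟨hF, fun b hb => by rw [hFf, (hSH b).1 hb f hf]⟩

theorem isRationalAlgebraic_comap_powHom {n : ℕ} {H : Subgroup (A.pow n).GLH₁}
    (hH : (A.pow n).IsRationalAlgebraic H) : A.IsRationalAlgebraic (H.comap (A.powHom n)) := by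
  obtain ⟨S, hS, hSH⟩ := hH
  refine ⟨(fun F a => F (A.powHom n a)) '' S, ?_, fun a => ?_⟩
  · rintro _ ⟨F, hF, rfl⟩
    exact powHom_comp_mem_rationalFunctions (hS hF)
  · rw [Subgroup.mem_comap, hSH, Set.forall_mem_image]

theorem powHom_hodgeHom {n : ℕ} (z : Circle) :
    A.powHom n (A.hodgeHom z) = (A.pow n).hodgeHom z :=
  LinearEquiv.ext fun x => pow_H₁_ext fun i => by
    rw [H₁map_proj_powHom, hodgeHom_H₁map]

/-- The Hodge group of `A ^ n`, for `n > 0`, is that of `A`, embedded diagonally. -/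
theorem hodgeGroup_pow {n : ℕ} (i₀ : Fin n) :
    (A.pow n).hodgeGroup = A.hodgeGroup.map (A.powHom n) := by
  apply le_antisymm
  · intro g hg
    have h1 : ∀ H, A.IsRationalAlgebraic H → (∀ z, A.hodgeHom z ∈ H) →
        g ∈ H.map (A.powHom n) := fun H hH hz =>
      Subgroup.mem_sInf.1 hg _ ⟨isRationalAlgebraic_map_powHom i₀ hH, fun z =>
        ⟨_, hz z, powHom_hodgeHom z⟩⟩
    -- `⊤` is among the groups `H`, so `g` is diagonal; by injectivity of the diagonal embedding the
    -- same block `a` lies in every `H`.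
    obtain ⟨a, -, rfl⟩ := h1 ⊤ ⟨∅, Set.empty_subset _, fun g => by simp⟩
      fun z => Subgroup.mem_top _
    refine ⟨a, Subgroup.mem_sInf.2 fun H hH => ?_, rfl⟩
    obtain ⟨b, hb, hab⟩ := h1 H hH.1 hH.2
    exact powHom_injective i₀ hab ▸ hb
  · rw [Subgroup.map_le_iff_le_comap]
    intro a ha
    refine Subgroup.mem_sInf.2 fun H hH => ?_
    refine Subgroup.mem_sInf.1 ha _ ⟨isRationalAlgebraic_comap_powHom hH.1, fun z => ?_⟩
    rw [Subgroup.mem_comap, powHom_hodgeHom]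
    exact hH.2 z

theorem derivedHodgeGroup_pow {n : ℕ} (i₀ : Fin n) :
    (A.pow n).derivedHodgeGroup = A.derivedHodgeGroup.map (A.powHom n) := by
  rw [derivedHodgeGroup, derivedHodgeGroup, Subgroup.map_commutator, hodgeGroup_pow i₀]

/-! ### Powers of weakly self-dominated abelian varieties -/

/-- Pulling back forms, as a linear map. -/
def pullback (f : A.Lie →ₗ[ℂ] B.Lie) (n : ℕ) : B.Coh n →ₗ[ℂ] A.Coh n where
  toFun φ := φ.compLinearMap (H₁map f)
  map_add' _ _ := rfl
  map_smul' _ _ := rfl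

theorem pullback_apply (f : A.Lie →ₗ[ℂ] B.Lie) {n : ℕ} (φ : B.Coh n) :
    pullback f n φ = φ.compLinearMap (H₁map f) := rfl

theorem IsWeaklySelfDominated.pow (hA : A.IsWeaklySelfDominated) (n : ℕ) :
    (A.pow n).IsWeaklySelfDominated := by
  rw [isWeaklySelfDominated_iff]
  intro U _ _ _ ρ hρ hirr hnt
  rcases Nat.eq_zero_or_pos n with rfl | hn
  -- `A ^ 0` has trivial homology, so its group has no nontrivial representation.
  · obtain ⟨g, v, hgv⟩ := hnt
    have hg : g = 1 := Subtype.ext (LinearEquiv.ext fun x => pow_H₁_ext fun i => i.elim0)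
    rw [hg, map_one] at hgv
    exact (hgv rfl).elim
  · let i₀ : Fin n := ⟨0, hn⟩
    have hmem : ∀ a : A.derivedHodgeGroup, A.powHom n a ∈ (A.pow n).derivedHodgeGroup := fun a =>
      derivedHodgeGroup_pow i₀ ▸ Subgroup.mem_map_of_mem _ a.2
    let θ : A.derivedHodgeGroup →* (A.pow n).derivedHodgeGroup :=
      ((A.powHom n).comp A.derivedHodgeGroup.subtype).codRestrict _ hmem
    have hθ : ∀ g, ∃ a, θ a = g := by
      rintro ⟨g, hg⟩
      obtain ⟨a, ha, rfl⟩ := (derivedHodgeGroup_pow i₀).le hg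
      exact ⟨⟨a, ha⟩, rfl⟩
    let ρ' : Representation ℂ A.derivedHodgeGroup U := ρ.comp θ
    have hρ' : A.IsAlgebraicRep ρ' := by
      intro v l
      obtain ⟨f, hf, hfg⟩ := hρ v l
      exact ⟨_, powHom_comp_mem_regularFunctions hf, fun a => hfg (θ a)⟩
    have hirr' : ρ'.IsIrreducible := by
      rw [Representation.isIrreducible_iff] at hirr ⊢
      refine ⟨hirr.1, fun N hN => hirr.2 N fun g => ?_⟩
      obtain ⟨a, rfl⟩ := hθ g
      exact hN a
    obtain ⟨c, d, hcd, E, hE⟩ := hA.exists_realises ρ' hρ' hirr'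
    obtain ⟨hc, hd⟩ := hcd (by
      obtain ⟨g, v, hgv⟩ := hnt
      obtain ⟨a, rfl⟩ := hθ g
      exact ⟨a, v, hgv⟩)
    have hid : A.proj n i₀ ∘ₗ A.single n i₀ = LinearMap.id := by
      rw [proj_comp_single, if_pos rfl]
    let P : ((A.pow n).pow d).Lie →ₗ[ℂ] (A.pow d).Lie := powMap (A.proj n i₀) id
    have hinj : Function.Injective (pullback P c) := fun φ ψ h =>
      compLinearMap_injective (powMap_powSection_eq_id hid Function.injective_id) h
    refine ⟨c, d, hc, hd, pullback P c ∘ₗ E, hinj.comp hE.injective, ?_, ?_, ?_⟩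
    · intro g hg u
      obtain ⟨a, ha, hga⟩ := exists_mem_lefschetzGroup hid (proj_mem_lattice i₀)
        (single_mem_lattice i₀) hg
      obtain ⟨u', hu'⟩ := hE.lefschetz a ha u
      refine ⟨u', ?_⟩
      rw [LinearMap.comp_apply, LinearMap.comp_apply, ← hu']
      exact act_compLinearMap hga id (E u)
    · intro g u
      obtain ⟨a, rfl⟩ := hθ g
      have h1 : E (ρ (θ a) u) = A.act a (E u) := hE.equivariant a u
      rw [LinearMap.comp_apply, LinearMap.comp_apply, h1]
      exact (act_compLinearMap (fun x => H₁map_proj_powHom (a : A.GLH₁) i₀ x) id (E u)).symm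
    · intro σ
      obtain ⟨u, ψ, hψ, h0, hh⟩ := hE.holomorphic σ
      exact ⟨u, pullback P c ψ, hψ.compLinearMap (powMap_mem_lattice (proj_mem_lattice i₀) id),
        fun h => h0 (hinj (h.trans (map_zero _).symm)), hh.compLinearMap P⟩

end AbelianVariety

/-! ### Products of weakly self-dominated abelian varieties -/

namespace AbelianVariety

variable {A B : AbelianVariety.{u}}

/-- The block diagonal action `GL(H₁(A)) × GL(H₁(B)) → GL(H₁(A × B))`. -/
def blockHom (A B : AbelianVariety.{u}) : A.GLH₁ × B.GLH₁ →* (A.prod B).GLH₁ where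
  toFun g := LinearEquiv.ofLinearMap (blockDiag A B g.1.toLinearMap g.2.toLinearMap)
    (blockDiag A B (g.1⁻¹ : A.GLH₁).toLinearMap (g.2⁻¹ : B.GLH₁).toLinearMap)
    (LinearMap.ext fun x => prod_H₁_ext
      (by
        rw [LinearMap.comp_apply, H₁map_fst_blockDiag, H₁map_fst_blockDiag]
        exact apply_inv_self g.1 _)
      (by
        rw [LinearMap.comp_apply, H₁map_snd_blockDiag, H₁map_snd_blockDiag]
        exact apply_inv_self g.2 _))
    (LinearMap.ext fun x => prod_H₁_ext
      (by
        rw [LinearMap.comp_apply, H₁map_fst_blockDiag, H₁map_fst_blockDiag]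
        exact inv_apply_self g.1 _)
      (by
        rw [LinearMap.comp_apply, H₁map_snd_blockDiag, H₁map_snd_blockDiag]
        exact inv_apply_self g.2 _))
  map_one' := LinearEquiv.ext fun x =>
    prod_H₁_ext (H₁map_fst_blockDiag _ _ x) (H₁map_snd_blockDiag _ _ x)
  map_mul' g h := LinearEquiv.ext fun x => prod_H₁_ext
    (by
      change H₁map (fst A B) (blockDiag A B (g * h).1.toLinearMap (g * h).2.toLinearMap x) =
        H₁map (fst A B) (blockDiag A B g.1.toLinearMap g.2.toLinearMap
          (blockDiag A B h.1.toLinearMap h.2.toLinearMap x))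
      rw [H₁map_fst_blockDiag, H₁map_fst_blockDiag, H₁map_fst_blockDiag]
      rfl)
    (by
      change H₁map (snd A B) (blockDiag A B (g * h).1.toLinearMap (g * h).2.toLinearMap x) =
        H₁map (snd A B) (blockDiag A B g.1.toLinearMap g.2.toLinearMap
          (blockDiag A B h.1.toLinearMap h.2.toLinearMap x))
      rw [H₁map_snd_blockDiag, H₁map_snd_blockDiag, H₁map_snd_blockDiag]
      rfl)

theorem blockHom_apply (a : A.GLH₁) (b : B.GLH₁) (x : (A.prod B).H₁) :
    blockHom A B (a, b) x = H₁map (inl A B) (a (H₁map (fst A B) x)) +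
      H₁map (inr A B) (b (H₁map (snd A B) x)) := rfl

theorem H₁map_fst_blockHom (a : A.GLH₁) (b : B.GLH₁) (x : (A.prod B).H₁) :
    H₁map (fst A B) (blockHom A B (a, b) x) = a (H₁map (fst A B) x) :=
  H₁map_fst_blockDiag _ _ x

theorem H₁map_snd_blockHom (a : A.GLH₁) (b : B.GLH₁) (x : (A.prod B).H₁) :
    H₁map (snd A B) (blockHom A B (a, b) x) = b (H₁map (snd A B) x) :=
  H₁map_snd_blockDiag _ _ x

theorem blockHom_left_comp_mem_regularFunctions {F : (A.prod B).GLH₁ → ℂ}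
    (hF : F ∈ (A.prod B).regularFunctions) :
    (fun a => F (blockHom A B (a, 1))) ∈ A.regularFunctions := by
  refine comp_mem_regularFunctions (fun v l => ?_) (fun v l => ?_) hF
  · have h := A.regularFunctions.add_mem
      (coeff_mem_regularFunctions (H₁map (fst A B) v) (l ∘ₗ H₁map (inl A B)))
      (A.regularFunctions.algebraMap_mem (l (H₁map (inr A B) (H₁map (snd A B) v))))
    convert h using 1
    ext a
    simp [blockHom_apply]
  · have h := A.regularFunctions.add_mem
      (inv_coeff_mem_regularFunctions (H₁map (fst A B) v) (l ∘ₗ H₁map (inl A B)))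
      (A.regularFunctions.algebraMap_mem (l (H₁map (inr A B) (H₁map (snd A B) v))))
    convert h using 1
    ext a
    rw [← map_inv, Prod.inv_mk, inv_one, blockHom_apply]
    simp

theorem blockHom_right_comp_mem_regularFunctions {F : (A.prod B).GLH₁ → ℂ}
    (hF : F ∈ (A.prod B).regularFunctions) :
    (fun b => F (blockHom A B (1, b))) ∈ B.regularFunctions := by
  refine comp_mem_regularFunctions (fun v l => ?_) (fun v l => ?_) hF
  · have h := B.regularFunctions.add_mem
      (B.regularFunctions.algebraMap_mem (l (H₁map (inl A B) (H₁map (fst A B) v))))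
      (coeff_mem_regularFunctions (H₁map (snd A B) v) (l ∘ₗ H₁map (inr A B)))
    convert h using 1
    ext a
    simp [blockHom_apply]
  · have h := B.regularFunctions.add_mem
      (B.regularFunctions.algebraMap_mem (l (H₁map (inl A B) (H₁map (fst A B) v))))
      (inv_coeff_mem_regularFunctions (H₁map (snd A B) v) (l ∘ₗ H₁map (inr A B)))
    convert h using 1
    ext a
    rw [← map_inv, Prod.inv_mk, inv_one, blockHom_apply]
    simp

theorem fst_comp_inl (A B : AbelianVariety.{u}) : fst A B ∘ₗ inl A B = LinearMap.id :=
  LinearMap.fst_comp_inl ..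

theorem snd_comp_inr (A B : AbelianVariety.{u}) : snd A B ∘ₗ inr A B = LinearMap.id :=
  LinearMap.snd_comp_inr ..

theorem fst_comp_inr (A B : AbelianVariety.{u}) : fst A B ∘ₗ inr A B = 0 :=
  LinearMap.fst_comp_inr ..

theorem snd_comp_inl (A B : AbelianVariety.{u}) : snd A B ∘ₗ inl A B = 0 :=
  LinearMap.snd_comp_inl ..

/-- A representation which embeds equivariantly into an algebraic one is algebraic: a linear form on
it extends to the larger space. -/
theorem IsAlgebraicRep.of_equivariant {W U : Type} [AddCommGroup W] [Module ℂ W]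
    [AddCommGroup U] [Module ℂ U] {ρ : Representation ℂ A.derivedHodgeGroup U}
    (hρ : A.IsAlgebraicRep ρ) {τ : Representation ℂ A.derivedHodgeGroup W} {i : W →ₗ[ℂ] U}
    (hi : Function.Injective i) (h : ∀ g w, ρ g (i w) = i (τ g w)) : A.IsAlgebraicRep τ := by
  intro w l
  obtain ⟨r, hr⟩ := i.exists_leftInverse_of_injective (LinearMap.ker_eq_bot.2 hi)
  obtain ⟨f, hf, hfg⟩ := hρ (i w) (l ∘ₗ r)
  refine ⟨f, hf, fun g => ?_⟩
  rw [← hfg, h, LinearMap.comp_apply]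
  exact congrArg l (LinearMap.congr_fun hr (τ g w)).symm

/-- The map `φ ⊗ ψ ↦ f^* φ ∧ f'^* ψ`. -/
def cross {X Y Z : AbelianVariety.{u}} (f : X.Lie →ₗ[ℂ] Y.Lie) (f' : X.Lie →ₗ[ℂ] Z.Lie)
    {W M : Type} [AddCommGroup W] [Module ℂ W] [AddCommGroup M] [Module ℂ M] {m n : ℕ}
    (E : W →ₗ[ℂ] Y.Coh m) (E' : M →ₗ[ℂ] Z.Coh n) : W ⊗[ℂ] M →ₗ[ℂ] X.Coh (m + n) :=
  TensorProduct.lift (AlternatingMap.wedgeₗ.compl₁₂ (pullback f m ∘ₗ E) (pullback f' n ∘ₗ E'))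

theorem cross_tmul {X Y Z : AbelianVariety.{u}} (f : X.Lie →ₗ[ℂ] Y.Lie) (f' : X.Lie →ₗ[ℂ] Z.Lie)
    {W M : Type} [AddCommGroup W] [Module ℂ W] [AddCommGroup M] [Module ℂ M] {m n : ℕ}
    (E : W →ₗ[ℂ] Y.Coh m) (E' : M →ₗ[ℂ] Z.Coh n) (w : W) (x : M) :
    cross f f' E E' (w ⊗ₜ x) = (pullback f m (E w)).wedge (pullback f' n (E' x)) := rfl

/-- The values of `f^* φ ∧ f'^* ψ` on vectors from the two factors. -/
theorem exists_wedge_pullback_eq {X Y Z : AbelianVariety.{u}} {f : X.Lie →ₗ[ℂ] Y.Lie}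
    {f' : X.Lie →ₗ[ℂ] Z.Lie} {s : Y.Lie →ₗ[ℂ] X.Lie} {s' : Z.Lie →ₗ[ℂ] X.Lie}
    (h₁ : f ∘ₗ s = LinearMap.id) (h₂ : f' ∘ₗ s' = LinearMap.id) (h₃ : f' ∘ₗ s = 0) (m n : ℕ) :
    ∃ N : ℂ, N ≠ 0 ∧ ∀ (x : Fin m → Y.H₁) (y : Fin n → Z.H₁), ∃ v : Fin (m + n) → X.H₁,
      ∀ (φ : Y.Coh m) (ψ : Z.Coh n),
        (pullback f m φ).wedge (pullback f' n ψ) v = N * (φ x * ψ y) := by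
  obtain ⟨N, hN, h⟩ := AlternatingMap.exists_wedge_append_eq (k := ℂ) (M := X.H₁) m n
  refine ⟨N, hN, fun x y => ⟨_, fun φ ψ => (h _ _ (fun i => H₁map s (x i))
    (fun j => H₁map s' (y j)) ?_).trans ?_⟩⟩
  · rintro z j ⟨i, hi⟩
    refine ψ.map_coord_zero j ?_
    change H₁map f' (z j) = 0
    rw [← hi]
    change H₁map f' (H₁map s (x i)) = 0
    rw [H₁map_apply_apply, h₃, H₁map_zero, LinearMap.zero_apply]
  · simp [pullback_apply, H₁map_apply_apply, h₁, h₂]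

/-- The injectivity part of the Künneth formula. -/
theorem cross_injective {X Y Z : AbelianVariety.{u}} {f : X.Lie →ₗ[ℂ] Y.Lie}
    {f' : X.Lie →ₗ[ℂ] Z.Lie} {s : Y.Lie →ₗ[ℂ] X.Lie} {s' : Z.Lie →ₗ[ℂ] X.Lie}
    (h₁ : f ∘ₗ s = LinearMap.id) (h₂ : f' ∘ₗ s' = LinearMap.id) (h₃ : f' ∘ₗ s = 0)
    {W M : Type} [AddCommGroup W] [Module ℂ W] [FiniteDimensional ℂ W] [AddCommGroup M]
    [Module ℂ M] {m n : ℕ} {E : W →ₗ[ℂ] Y.Coh m} {E' : M →ₗ[ℂ] Z.Coh n}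
    (hE : Function.Injective E) (hE' : Function.Injective E') :
    Function.Injective (cross f f' E E') := by
  obtain ⟨N, hN, hw⟩ := exists_wedge_pullback_eq h₁ h₂ h₃ m n
  rw [injective_iff_map_eq_zero]
  intro t ht
  let b := Module.finBasis ℂ W
  obtain ⟨a, rfl⟩ := TensorProduct.eq_repr_basis_left b t
  rw [Finsupp.sum, map_sum] at ht
  have h0 : ∀ y : Fin n → Z.H₁, ∑ i ∈ a.support, E' (a i) y • b i = 0 := by
    intro y
    refine hE ?_
    ext x
    obtain ⟨v, hv⟩ := hw x y
    have h := congrArg (fun ω : X.Coh (m + n) => ω v) ht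
    simp only [cross_tmul, AlternatingMap.finset_sum_apply, hv, ← Finset.mul_sum,
      AlternatingMap.zero_apply, mul_eq_zero, hN, false_or] at h
    simpa [AlternatingMap.finset_sum_apply, mul_comm] using h
  have ha : ∀ i, a i = 0 := by
    intro i
    by_contra hi
    refine hi (hE' ?_)
    ext y
    rw [map_zero]
    exact linearIndependent_iff'.1 b.linearIndependent _ _ (h0 y) i (Finsupp.mem_support_iff.2 hi)
  simp [Finsupp.sum, ha]

theorem fst_mem_lattice : ∀ x ∈ (A.prod B).lattice, fst A B x ∈ A.lattice := fun _ hx => hx.1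

theorem snd_mem_lattice : ∀ x ∈ (A.prod B).lattice, snd A B x ∈ B.lattice := fun _ hx => hx.2

theorem inl_mem_lattice : ∀ x ∈ A.lattice, inl A B x ∈ (A.prod B).lattice :=
  fun _ hx => ⟨hx, B.lattice.zero_mem⟩

theorem inr_mem_lattice : ∀ x ∈ B.lattice, inr A B x ∈ (A.prod B).lattice :=
  fun _ hx => ⟨A.lattice.zero_mem, hx⟩

/-- If `W` and `M` are realised in the cohomology of powers of `A` and `B`, then `W ⊗ M` is
realised in the cohomology of a power of `A × B`, by products of forms which are pulled back from
disjoint sets of coordinates. -/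
theorem Realises.cross {W M U : Type} [AddCommGroup W] [Module ℂ W] [FiniteDimensional ℂ W]
    [AddCommGroup M] [Module ℂ M] [AddCommGroup U] [Module ℂ U] {G₁ : Subgroup A.GLH₁}
    {G₂ : Subgroup B.GLH₁} {G : Subgroup (A.prod B).GLH₁} {τ : Representation ℂ G₁ W}
    {τ' : Representation ℂ G₂ M} {ρ : Representation ℂ G U} {c d c' d' : ℕ}
    {E : W →ₗ[ℂ] (A.pow d).Coh c} {E' : M →ₗ[ℂ] (B.pow d').Coh c'} (hE : A.Realises τ E)
    (hE' : B.Realises τ' E') (T : W ⊗[ℂ] M ≃ₗ[ℂ] U)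
    (h : ∀ g : G, ∃ (a : G₁) (b : G₂),
      (∀ x, H₁map (fst A B) ((g : (A.prod B).GLH₁) x) = (a : A.GLH₁) (H₁map (fst A B) x)) ∧
      (∀ x, H₁map (snd A B) ((g : (A.prod B).GLH₁) x) = (b : B.GLH₁) (H₁map (snd A B) x)) ∧
      ∀ w m, ρ g (T (w ⊗ₜ m)) = T (τ a w ⊗ₜ τ' b m)) :
    (A.prod B).Realises ρ (AbelianVariety.cross (powMap (fst A B) (Fin.castAdd d'))
      (powMap (snd A B) (Fin.natAdd d)) E E' ∘ₗ T.symm.toLinearMap) := by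
  set p : ((A.prod B).pow (d + d')).Lie →ₗ[ℂ] (A.pow d).Lie := powMap (fst A B) (Fin.castAdd d')
    with hp_def
  set q : ((A.prod B).pow (d + d')).Lie →ₗ[ℂ] (B.pow d').Lie := powMap (snd A B) (Fin.natAdd d)
    with hq_def
  have hp : p ∘ₗ powSection (inl A B) (Fin.castAdd d') = LinearMap.id :=
    powMap_powSection_eq_id (fst_comp_inl A B) (Fin.castAdd_injective d d')
  have hq : q ∘ₗ powSection (inr A B) (Fin.natAdd d) = LinearMap.id :=
    powMap_powSection_eq_id (snd_comp_inr A B) (Fin.natAdd_injective d' d)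
  have hqp : q ∘ₗ powSection (inl A B) (Fin.castAdd d') = 0 :=
    powMap_powSection_eq_zero (snd_comp_inl A B) _ _
  set Θ := AbelianVariety.cross p q E E' with hΘ_def
  have hΘ : Function.Injective Θ := cross_injective hp hq hqp hE.injective hE'.injective
  have hact : ∀ (g : (A.prod B).GLH₁) (a : A.GLH₁) (b : B.GLH₁),
      (∀ x, H₁map (fst A B) (g x) = a (H₁map (fst A B) x)) →
      (∀ x, H₁map (snd A B) (g x) = b (H₁map (snd A B) x)) → ∀ w m,
      (A.prod B).act g (Θ (w ⊗ₜ m)) =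
        (pullback p c (A.act a (E w))).wedge (pullback q c' (B.act b (E' m))) := by
    intro g a b ha hb w m
    rw [hΘ_def, cross_tmul, act_wedge, pullback_apply, pullback_apply, hp_def, hq_def,
      act_compLinearMap ha, act_compLinearMap hb]
    rfl
  refine ⟨hΘ.comp T.symm.injective, ?_, ?_, ?_⟩
  · intro g hg u
    suffices h : ∀ t, ∃ t', (A.prod B).act g (Θ t) = Θ t' by
      obtain ⟨t', ht'⟩ := h (T.symm u)
      exact ⟨T t', by simpa using ht'⟩
    obtain ⟨a, ha, hga⟩ := exists_mem_lefschetzGroup (fst_comp_inl A B) fst_mem_lattice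
      inl_mem_lattice hg
    obtain ⟨b, hb, hgb⟩ := exists_mem_lefschetzGroup (snd_comp_inr A B) snd_mem_lattice
      inr_mem_lattice hg
    intro t
    induction t with
    | zero => exact ⟨0, by rw [map_zero]; exact map_zero ((A.prod B).actₗ _ _ g)⟩
    | add x y hx hy =>
      obtain ⟨x', hx⟩ := hx
      obtain ⟨y', hy⟩ := hy
      refine ⟨x' + y', ?_⟩
      rw [map_add, map_add, ← hx, ← hy]
      exact map_add ((A.prod B).actₗ _ _ g) _ _
    | tmul w m =>
      obtain ⟨w', hw'⟩ := hE.lefschetz a ha w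
      obtain ⟨m', hm'⟩ := hE'.lefschetz b hb m
      exact ⟨w' ⊗ₜ m', by rw [hact g a b hga hgb, hw', hm', hΘ_def, cross_tmul]⟩
  · intro g u
    obtain ⟨a, b, ha, hb, hab⟩ := h g
    have key : (Θ ∘ₗ T.symm.toLinearMap) ∘ₗ ρ g ∘ₗ T.toLinearMap =
        (A.prod B).actₗ _ _ g ∘ₗ Θ := by
      refine TensorProduct.ext' fun w m => ?_
      rw [LinearMap.comp_apply (f := (A.prod B).actₗ _ _ g), actₗ_apply, hact g a b ha hb,
        ← hE.equivariant, ← hE'.equivariant]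
      simp only [LinearMap.comp_apply, LinearEquiv.coe_coe, hab, LinearEquiv.symm_apply_apply]
      rfl
    simpa [actₗ_apply] using LinearMap.congr_fun key (T.symm u)
  · intro σ
    obtain ⟨w, ψ, hψ, h0, hh⟩ := hE.holomorphic σ
    obtain ⟨m, ψ', hψ', h0', hh'⟩ := hE'.holomorphic σ
    refine ⟨T (w ⊗ₜ m), (pullback p c ψ).wedge (pullback q c' ψ'), ?_, ?_, ?_⟩
    · rw [LinearMap.comp_apply, LinearEquiv.coe_coe, LinearEquiv.symm_apply_apply, hΘ_def,
        cross_tmul]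
      exact (hψ.compLinearMap (powMap_mem_lattice fst_mem_lattice _)).wedge
        (hψ'.compLinearMap (powMap_mem_lattice snd_mem_lattice _))
    · obtain ⟨N, hN, hw⟩ := exists_wedge_pullback_eq hp hq hqp c c'
      obtain ⟨x, hx⟩ := DFunLike.ne_iff.1 h0
      obtain ⟨y, hy⟩ := DFunLike.ne_iff.1 h0'
      obtain ⟨v, hv⟩ := hw x y
      intro h
      have h2 := hv ψ ψ'
      rw [h, AlternatingMap.zero_apply] at h2
      exact mul_ne_zero hN (mul_ne_zero hx hy) h2.symm
    · exact (hh.compLinearMap p).wedge (hh'.compLinearMap q)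

theorem apply_eq_self_of_tmul {W M U : Type*} [AddCommGroup W] [Module ℂ W] [AddCommGroup M]
    [Module ℂ M] [AddCommGroup U] [Module ℂ U] (T : W ⊗[ℂ] M ≃ₗ[ℂ] U) {f : U →ₗ[ℂ] U}
    (h : ∀ w m, f (T (w ⊗ₜ m)) = T (w ⊗ₜ m)) (u : U) : f u = u := by
  have key : f ∘ₗ T.toLinearMap = T.toLinearMap := TensorProduct.ext' h
  simpa using LinearMap.congr_fun key (T.symm u)

theorem tmul_left_injective {W M : Type*} [AddCommGroup W] [Module ℂ W] [AddCommGroup M]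
    [Module ℂ M] {m : M} (hm : m ≠ 0) : Function.Injective fun w : W => w ⊗ₜ[ℂ] m := by
  obtain ⟨l, hl⟩ := Module.Projective.exists_dual_eq_one ℂ hm
  intro w w' h
  have h1 := congrArg (TensorProduct.rid ℂ W ∘ l.lTensor W) h
  simpa [hl] using h1

theorem tmul_right_injective {W M : Type*} [AddCommGroup W] [Module ℂ W] [AddCommGroup M]
    [Module ℂ M] {w : W} (hw : w ≠ 0) : Function.Injective fun m : M => w ⊗ₜ[ℂ] m := by
  intro m m' h
  exact tmul_left_injective hw (by simpa using congrArg (TensorProduct.comm ℂ W M) h)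

theorem IsWeaklySelfDominated.prod (hA : A.IsWeaklySelfDominated) (hB : B.IsWeaklySelfDominated)
    (hAB : DerivedHodgeGroupIsProduct A B) : (A.prod B).IsWeaklySelfDominated := by
  rw [isWeaklySelfDominated_iff]
  intro U _ _ _ ρ hρ hirr hnt
  have hmem : ∀ a ∈ A.derivedHodgeGroup, ∀ b ∈ B.derivedHodgeGroup,
      blockHom A B (a, b) ∈ (A.prod B).derivedHodgeGroup := fun a ha b hb =>
    (hAB _).2 ⟨a, ha, b, hb, rfl⟩
  let θ₁ : A.derivedHodgeGroup →* (A.prod B).derivedHodgeGroup :=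
    ((blockHom A B).comp ((MonoidHom.inl _ _).comp A.derivedHodgeGroup.subtype)).codRestrict _
      fun a => hmem a a.2 1 (Subgroup.one_mem _)
  let θ₂ : B.derivedHodgeGroup →* (A.prod B).derivedHodgeGroup :=
    ((blockHom A B).comp ((MonoidHom.inr _ _).comp B.derivedHodgeGroup.subtype)).codRestrict _
      fun b => hmem 1 (Subgroup.one_mem _) b b.2
  have hθ₁₂ : ∀ a b, ((θ₁ a * θ₂ b : (A.prod B).derivedHodgeGroup) : (A.prod B).GLH₁) =
      blockHom A B (a, b) := fun a b => by
    change blockHom A B (a, 1) * blockHom A B (1, b) = _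
    rw [← map_mul, Prod.mk_mul_mk, mul_one, one_mul]
  have hθ₂₁ : ∀ a b, θ₂ b * θ₁ a = θ₁ a * θ₂ b := fun a b => Subtype.ext <| by
    rw [hθ₁₂]
    change blockHom A B (1, b) * blockHom A B (a, 1) = _
    rw [← map_mul, Prod.mk_mul_mk, mul_one, one_mul]
  have hθ : ∀ g, ∃ a b, θ₁ a * θ₂ b = g := by
    rintro ⟨g, hg⟩
    obtain ⟨a, ha, b, hb, hab⟩ := (hAB g).1 hg
    exact ⟨⟨a, ha⟩, ⟨b, hb⟩, Subtype.ext ((hθ₁₂ _ _).trans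
      (LinearEquiv.toLinearMap_injective hab.symm))⟩
  let ρ₁ : Representation ℂ A.derivedHodgeGroup U := ρ.comp θ₁
  let ρ₂ : Representation ℂ B.derivedHodgeGroup U := ρ.comp θ₂
  have hmul : ∀ a b u, ρ (θ₁ a * θ₂ b) u = ρ₁ a (ρ₂ b u) := fun a b u => by
    rw [map_mul]; rfl
  have hc : ∀ a b u, ρ₁ a (ρ₂ b u) = ρ₂ b (ρ₁ a u) := fun a b u => by
    rw [← hmul, ← hθ₂₁, map_mul]; rfl
  have hρ₁ : A.IsAlgebraicRep ρ₁ := fun v l => by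
    obtain ⟨f, hf, hfg⟩ := hρ v l
    exact ⟨_, blockHom_left_comp_mem_regularFunctions hf, fun a => hfg (θ₁ a)⟩
  have hρ₂ : B.IsAlgebraicRep ρ₂ := fun v l => by
    obtain ⟨f, hf, hfg⟩ := hρ v l
    exact ⟨_, blockHom_right_comp_mem_regularFunctions hf, fun b => hfg (θ₂ b)⟩
  rw [Representation.isIrreducible_iff] at hirr
  obtain ⟨W, M, _, _, _, _, _, _, τ, τ', T, hτ, hτ', hT₁, hT₂⟩ :=
    Representation.exists_externalTensor_equiv ρ₁ ρ₂ hc hirr.1 fun N h1 h2 => hirr.2 N fun g u hu =>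
      by
        obtain ⟨a, b, rfl⟩ := hθ g
        rw [hmul]
        exact h1 _ _ (h2 _ _ hu)
  have hTρ : ∀ a b w m, T (τ a w ⊗ₜ τ' b m) = ρ (θ₁ a * θ₂ b) (T (w ⊗ₜ m)) := by
    intro a b w m
    rw [hmul, hT₂, hT₁]
  -- `W` and `M` are algebraic because they embed into `U` equivariantly.
  obtain ⟨w₀, hw₀⟩ := ((Representation.isIrreducible_iff τ).1 hτ).1
  obtain ⟨m₀, hm₀⟩ := ((Representation.isIrreducible_iff τ').1 hτ').1
  have hτalg : A.IsAlgebraicRep τ :=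
    hρ₁.of_equivariant (i := T.toLinearMap ∘ₗ (TensorProduct.mk ℂ W M).flip m₀)
      (T.injective.comp (tmul_left_injective hm₀)) fun g w => hT₁ g w m₀
  have hτalg' : B.IsAlgebraicRep τ' :=
    hρ₂.of_equivariant (i := T.toLinearMap ∘ₗ TensorProduct.mk ℂ W M w₀)
      (T.injective.comp (tmul_right_injective hw₀)) fun g m => hT₂ g w₀ m
  obtain ⟨c, d, hcd, E, hE⟩ := hA.exists_realises τ hτalg hτ
  obtain ⟨c', d', hcd', E', hE'⟩ := hB.exists_realises τ' hτalg' hτ'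
  -- As `ρ` is nontrivial, at least one of the two factors is.
  have hpos : 0 < c + c' ∧ 0 < d + d' := by
    by_cases h1 : ∃ a w, τ a w ≠ w
    · have := hcd h1
      omega
    by_cases h2 : ∃ b m, τ' b m ≠ m
    · have := hcd' h2
      omega
    push Not at h1 h2
    obtain ⟨g, u, hgu⟩ := hnt
    obtain ⟨a, b, rfl⟩ := hθ g
    exact (hgu (apply_eq_self_of_tmul T (fun w m => by rw [← hTρ, h1, h2]) u)).elim
  refine ⟨c + c', d + d', hpos.1, hpos.2, _, hE.cross hE' T fun g => ?_⟩
  obtain ⟨a, b, rfl⟩ := hθ g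
  refine ⟨a, b, ?_, ?_, fun w m => (hTρ a b w m).symm⟩
  · rw [hθ₁₂]
    exact H₁map_fst_blockHom _ _
  · rw [hθ₁₂]
    exact H₁map_snd_blockHom _ _

end AbelianVariety

end

theorem lemma4p2 :
    (∀ A : AbelianVariety.{u}, A.IsCMType → A.IsWeaklySelfDominated) ∧
    (∀ (A : AbelianVariety.{u}) (n : ℕ),
      A.IsWeaklySelfDominated → (A.pow n).IsWeaklySelfDominated) ∧
    (∀ A B : AbelianVariety.{u}, A.IsWeaklySelfDominated → B.IsWeaklySelfDominated →
      AbelianVariety.DerivedHodgeGroupIsProduct A B →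
      (A.prod B).IsWeaklySelfDominated) := by
  exact ⟨fun _ h => h.isWeaklySelfDominated, fun _ n h => h.pow n,
    fun _ _ hA hB h => hA.prod hB h⟩
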